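/- Let $k$ be a field and $Q$ a finite quiver with vertex set $Q_0$. In the path algebra $kQ$ the product $\beta\alpha$ of two paths means "first $\alpha$, then $\beta$" (it is $0$ if $t(\alpha)\neq s(\beta)$), and vertices are regarded as idempotents. For $n\geq 0$ let $\langle Q_n\rangle$ be the two-sided ideal of $kQ$ generated by the paths of length $n$. Let $I$ be a two-sided ideal of $kQ$ with $\langle Q_n\rangle\subseteq I\subseteq\langle Q_2\rangle$ for some $n\geq 2$, and let $B=kQ/I$. Let $F$ be a finite set of new arrows with source and target maps $s,t:F\to Q_0$, let $Q_F$ be the quiver with vertex set $Q_0$ and set of arrows $Q_1\sqcup F$, and let $B_F=kQ_F/\langle I\rangle$, where $\langle I\rangle$ is the two-sided ideal of $kQ_F$ generated by $I$. A relative path is a sequence $\gamma=(a_n,\dots,a_1)$, $n>0$, of elements of $F$ with $s(a_{i+1})Bt(a_i)\neq 0$ for $1\leq i\leq n-1$; put $s(\gamma)=s(a_1)$, $t(\gamma)=t(a_n)$ and $\dim\gamma=\prod_{i=1}^{n-1}\dim_k s(a_{i+1})Bt(a_i)$. Let $R_*$ be the set of relative paths. A relative cycle is a relative path $\gamma$ with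 $s(\gamma)Bt(\gamma)\neq 0$. An extended relative path $\omega$ is either a pair $(y,x)$ of vertices with $yBx\neq 0$, in which case $\dim\omega=\dim_k yBx$, or a triple $(y,\gamma,x)$ with $y,x\in Q_0$, $\gamma\in R_*$, $yBt(\gamma)\neq 0$ and $s(\gamma)Bx\neq 0$, in which case $\dim\omega=\dim_k yBt(\gamma)\cdot\dim\gamma\cdot\dim_k s(\gamma)Bx$; in both cases $s(\omega)=x$ and $t(\omega)=y$. Let $F/\!/W_*$ be the set of pairs $(a,\omega)$ of a new arrow $a\in F$ and an extended relative path $\omega$ with $s(a)=s(\omega)$ and $t(a)=t(\omega)$. For $x\in Q_0$ let $P_x$ and $I_x$ be the projective cover and the injective envelope of the simple left $B$-module at $x$. Write $ZA$ for the centre and $HH^1(A)$ for the first Hochschild cohomology of a $k$-algebra $A$. Suppose that there are no relative cycles. Then $B$ and $B_F$ are finite dimensional over $k$, the sets $R_*$ and $F/\!/W_*$ are finite, the spaces $\mathrm{Hom}_B(I_x,P_y)$ and $\mathrm{Ext}^1_B(I_x,P_y)$ are finite dimensional for all $x,y\in Q_0$, and $$\dim_k HH^1(B_F)-\dim_k HH^1(B)=\dim_k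 ZB_F-\dim_k ZB+\sum_{(a,\omega)\in F/\!/W_*}\dim\omega+\sum_{\gamma\in R_*}\dim\gamma\,\bigl(\dim_k\mathrm{Ext}^1_B(I_{s(\gamma)},P_{t(\gamma)})-\dim_k\mathrm{Hom}_B(I_{s(\gamma)},P_{t(\gamma)})\bigr).$$ -/

import Mathlib

open CategoryTheory

universe w v u

/-! ### Path algebras -/

/-- The set `Q_*` of all paths of a quiver (vertices included, as the paths of length `0`). -/
structure QPath (V : Type u) [Quiver.{v} V] where
  src : V
  tgt : V
  path : Quiver.Path src tgt

/-- The underlying vector space of the path algebra `kQ`: it has the paths as a basis. -/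
def PathAlgebra (k : Type w) (V : Type u) [Quiver.{v} V] [Field k] : Type (max u v w) :=
  QPath V →₀ k

namespace PathAlgebra

variable {k : Type w} {V : Type u} [Quiver.{v} V] [Field k]

noncomputable instance : AddCommGroup (PathAlgebra k V) :=
  inferInstanceAs (AddCommGroup (QPath V →₀ k))

noncomputable instance : Module k (PathAlgebra k V) :=
  inferInstanceAs (Module k (QPath V →₀ k))

/-- The basis element attached to a path. -/
noncomputable def of (p : QPath V) : PathAlgebra k V :=
  Finsupp.single p (1 : k)

/-- The linear map out of `kQ` with prescribed values on the paths. -/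
noncomputable def lift {M : Type*} [AddCommGroup M] [Module k M] (f : QPath V → M) :
    PathAlgebra k V →ₗ[k] M :=
  Finsupp.linearCombination k f

@[simp] theorem lift_of {M : Type*} [AddCommGroup M] [Module k M] (f : QPath V → M)
    (p : QPath V) : lift f (of p : PathAlgebra k V) = f p := by
  exact (Finsupp.linearCombination_single k 1 p).trans (one_smul k _)

theorem hom_ext {M : Type*} [AddCommGroup M] [Module k M] {f g : PathAlgebra k V →ₗ[k] M}
    (h : ∀ p, f (of p) = g (of p)) : f = g :=
  Finsupp.lhom_ext' fun p => LinearMap.ext_ring (h p)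

open Classical in
/-- The product `β α` of two paths: the concatenation "first `α`, then `β`" if
`t(α) = s(β)`, and `0` otherwise. -/
noncomputable def pathMul (β α : QPath V) : PathAlgebra k V :=
  if h : α.tgt = β.src then of ⟨α.src, β.tgt, (α.path.cast rfl h).comp β.path⟩ else 0

/-- The bilinear extension of the product of paths. -/
noncomputable def mulₗ : PathAlgebra k V →ₗ[k] PathAlgebra k V →ₗ[k] PathAlgebra k V :=
  lift fun β => lift fun α => pathMul β α

noncomputable instance : Mul (PathAlgebra k V) := ⟨fun x y => mulₗ x y⟩

theorem mul_def (x y : PathAlgebra k V) : x * y = mulₗ x y := rfl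

theorem of_mul_of (β α : QPath V) : (of β * of α : PathAlgebra k V) = pathMul β α := by
  simp [mul_def, mulₗ]

theorem of_mul_of_comp {x y z : V} (p : Quiver.Path x y) (q : Quiver.Path y z) :
    (of ⟨y, z, q⟩ * of ⟨x, y, p⟩ : PathAlgebra k V) = of ⟨x, z, p.comp q⟩ := by
  simp [of_mul_of, pathMul]

theorem of_mul_of_ne {β α : QPath V} (h : α.tgt ≠ β.src) :
    (of β * of α : PathAlgebra k V) = 0 := by
  simp [of_mul_of, pathMul, h]

theorem mul_assoc_of (p q r : QPath V) :
    (of p * of q * of r : PathAlgebra k V) = of p * (of q * of r) := by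
  obtain ⟨a, b, p⟩ := p
  obtain ⟨c, d, q⟩ := q
  obtain ⟨e, f, r⟩ := r
  have z1 : ∀ x : PathAlgebra k V, x * 0 = 0 := fun x => by simp [mul_def]
  have z2 : ∀ x : PathAlgebra k V, 0 * x = 0 := fun x => by simp [mul_def]
  by_cases h1 : d = a
  · subst h1
    by_cases h2 : f = c
    · subst h2
      simp only [of_mul_of_comp, Quiver.Path.comp_assoc]
    · rw [of_mul_of_comp, of_mul_of_ne h2, of_mul_of_ne h2, z1]
  · by_cases h2 : f = c
    · subst h2
      rw [of_mul_of_comp, of_mul_of_ne h1, of_mul_of_ne h1, z2]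
    · rw [of_mul_of_ne h1, of_mul_of_ne h2, z1, z2]

/-- The vertex `x`, seen as an idempotent of `kQ`. -/
noncomputable def vertex (x : V) : PathAlgebra k V := of ⟨x, x, Quiver.Path.nil⟩

noncomputable instance [Fintype V] : One (PathAlgebra k V) := ⟨∑ x : V, vertex x⟩

theorem one_def [Fintype V] : (1 : PathAlgebra k V) = ∑ x : V, vertex x := rfl

theorem mul_assoc' (x y z : PathAlgebra k V) : x * y * z = x * (y * z) := by
  have h1 : ∀ p q : QPath V, mulₗ (of p * of q : PathAlgebra k V) =
      mulₗ (of p) ∘ₗ mulₗ (of q) := fun p q => hom_ext fun r => mul_assoc_of p q r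
  have h2 : ∀ p : QPath V, mulₗ.flip z ∘ₗ mulₗ (of p : PathAlgebra k V) =
      mulₗ (of p) ∘ₗ mulₗ.flip z :=
    fun p => hom_ext fun q => LinearMap.congr_fun (h1 p q) z
  have h3 : mulₗ.flip z ∘ₗ mulₗ.flip y = mulₗ.flip (mulₗ y z) :=
    hom_ext fun p => LinearMap.congr_fun (h2 p) y
  exact LinearMap.congr_fun h3 x

theorem one_mul' [Fintype V] (x : PathAlgebra k V) : 1 * x = x := by
  have h : mulₗ (1 : PathAlgebra k V) = LinearMap.id := by
    refine hom_ext fun p => ?_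
    obtain ⟨a, b, p⟩ := p
    rw [one_def, map_sum, LinearMap.sum_apply, Finset.sum_eq_single b]
    · exact of_mul_of_comp (k := k) p Quiver.Path.nil
    · intro c _ hc
      have hne : b ≠ c := fun h => hc h.symm
      exact of_mul_of_ne (β := ⟨c, c, Quiver.Path.nil⟩) (α := ⟨a, b, p⟩) hne
    · simp
  exact LinearMap.congr_fun h x

theorem mul_one' [Fintype V] (x : PathAlgebra k V) : x * 1 = x := by
  have h : mulₗ.flip (1 : PathAlgebra k V) = LinearMap.id := by
    refine hom_ext fun p => ?_
    obtain ⟨a, b, p⟩ := p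
    rw [one_def, map_sum, LinearMap.sum_apply, Finset.sum_eq_single a]
    · exact (of_mul_of_comp Quiver.Path.nil p).trans (by simp)
    · intro c _ hc
      exact of_mul_of_ne (β := ⟨a, b, p⟩) (α := ⟨c, c, Quiver.Path.nil⟩) hc
    · simp
  exact LinearMap.congr_fun h x

noncomputable instance [Fintype V] : Ring (PathAlgebra k V) where
  __ := (inferInstance : AddCommGroup (PathAlgebra k V))
  left_distrib x y z := by simp [mul_def]
  right_distrib x y z := by simp [mul_def]
  zero_mul x := by simp [mul_def]
  mul_zero x := by simp [mul_def]
  mul_assoc := mul_assoc'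
  one_mul := one_mul'
  mul_one := mul_one'

noncomputable instance [Fintype V] : Algebra k (PathAlgebra k V) :=
  Algebra.ofModule (fun r x y => by simp [mul_def]) (fun r x y => by simp [mul_def])

variable (k V) in
/-- The two-sided ideal `⟨Q_n⟩` of `kQ` generated by the paths of length `n`. -/
noncomputable def lengthIdeal [Fintype V] (n : ℕ) : TwoSidedIdeal (PathAlgebra k V) :=
  TwoSidedIdeal.span {x | ∃ p : QPath V, p.path.length = n ∧ x = of p}

/-- A two-sided ideal `I` of `kQ` is admissible if `⟨Q_n⟩ ⊆ I ⊆ ⟨Q_2⟩` for some `n ≥ 2`. -/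
def IsAdmissible [Fintype V] (I : TwoSidedIdeal (PathAlgebra k V)) : Prop :=
  ∃ n, 2 ≤ n ∧ lengthIdeal k V n ≤ I ∧ I ≤ lengthIdeal k V 2

end PathAlgebra

/-! ### Bound quiver algebras and new arrows -/

section BoundQuiver

variable {k : Type w} {V : Type u} [Quiver.{v} V] [Field k] [Fintype V]

/-- The algebra `kQ/I`. -/
abbrev BoundQuiverAlgebra (I : TwoSidedIdeal (PathAlgebra k V)) : Type (max u v w) :=
  PathAlgebra k V ⧸ I.asIdeal

/-- The idempotent of `kQ/I` given by a vertex. -/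
noncomputable def BoundQuiverAlgebra.vertex (I : TwoSidedIdeal (PathAlgebra k V)) (x : V) :
    BoundQuiverAlgebra I :=
  Ideal.Quotient.mk I.asIdeal (PathAlgebra.vertex x)

end BoundQuiver

/-- The vertices of the quiver `Q_F`, where `F` is a set of new arrows with source and target
maps `s, t : F → Q_0`. They are the vertices of `Q`. -/
def AddArrows {V : Type u} {F : Type v} (_s _t : F → V) : Type u := V

section AddArrows

variable {V : Type u} [Quiver.{v} V] {F : Type v} (s t : F → V)

/-- The arrows of `Q_F`: the arrows of `Q` and the elements of `F`. -/
instance : Quiver.{v} (AddArrows s t) where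
  Hom x y := @Quiver.Hom V _ x y ⊕ {a : F // s a = x ∧ t a = y}

instance [Fintype V] : Fintype (AddArrows s t) := inferInstanceAs (Fintype V)

/-- The inclusion of the quiver `Q` in `Q_F`. -/
def AddArrows.incl : V ⥤q AddArrows s t where
  obj x := x
  map a := Sum.inl a

variable {k : Type w} [Field k]

/-- The inclusion of `kQ` in `kQ_F`, sending each path of `Q` to itself. -/
noncomputable def PathAlgebra.incl : PathAlgebra k V →ₗ[k] PathAlgebra k (AddArrows s t) :=
  PathAlgebra.lift fun p => PathAlgebra.of
    ⟨(AddArrows.incl s t).obj p.src, (AddArrows.incl s t).obj p.tgt,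
      (AddArrows.incl s t).mapPath p.path⟩

/-- The two-sided ideal `⟨I⟩` of `kQ_F` generated by `I`. -/
noncomputable def addArrowsIdeal [Fintype V] (I : TwoSidedIdeal (PathAlgebra k V)) :
    TwoSidedIdeal (PathAlgebra k (AddArrows s t)) :=
  TwoSidedIdeal.span (PathAlgebra.incl s t '' {x | x ∈ I})

/-- The algebra `B_F = kQ_F/⟨I⟩` attached to `B = kQ/I`. -/
abbrev BF [Fintype V] (I : TwoSidedIdeal (PathAlgebra k V)) : Type (max u v w) :=
  BoundQuiverAlgebra (addArrowsIdeal s t I)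

end AddArrows

/-! ### Relative paths -/

section RelativePaths

variable {k : Type w} {V : Type u} [Quiver.{v} V] [Field k] [Fintype V]
  {F : Type v} (s t : F → V) (I : TwoSidedIdeal (PathAlgebra k V))

/-- The subspace `yBx` of `B = kQ/I`, for vertices `y` and `x`. -/
noncomputable def corner (y x : V) : Submodule k (BoundQuiverAlgebra I) :=
  LinearMap.range (LinearMap.mulLeftRight k
    (BoundQuiverAlgebra.vertex I y, BoundQuiverAlgebra.vertex I x))

/-- A relative path `(a_n, …, a_1)` with `n > 0`. Here `n = m + 1` and `a_{i+1} = arrow i`. -/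
structure RelPath where
  m : ℕ
  arrow : Fin (m + 1) → F
  chain : ∀ i : Fin m, corner I (s (arrow i.succ)) (t (arrow i.castSucc)) ≠ ⊥

namespace RelPath

variable {s t I}

/-- `s(γ) = s(a_1)` -/
def src (γ : RelPath s t I) : V := s (γ.arrow 0)

/-- `t(γ) = t(a_n)` -/
def tgt (γ : RelPath s t I) : V := t (γ.arrow (Fin.last γ.m))

/-- The dimension of a relative path: the product of the `dim s(a_{i+1}) B t(a_i)`. -/
noncomputable def dim (γ : RelPath s t I) : ℕ :=
  ∏ i : Fin γ.m, Module.finrank k (corner I (s (γ.arrow i.succ)) (t (γ.arrow i.castSucc)))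

/-- A relative cycle is a relative path `γ` with `s(γ) B t(γ) ≠ 0`. -/
def IsCycle (γ : RelPath s t I) : Prop := corner I γ.src γ.tgt ≠ ⊥

end RelPath

/-- The extended relative paths: `(y, x)` with `yBx ≠ 0` (length zero), and `(y, γ, x)` with
`γ` a relative path, `y B t(γ) ≠ 0` and `s(γ) B x ≠ 0` (positive length). -/
inductive ExtRelPath where
  | zero (y x : V) (h : corner I y x ≠ ⊥) : ExtRelPath
  | pos (y : V) (γ : RelPath s t I) (x : V) (hy : corner I y γ.tgt ≠ ⊥)
      (hx : corner I γ.src x ≠ ⊥) : ExtRelPath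

namespace ExtRelPath

variable {s t I}

def src : ExtRelPath s t I → V
  | zero _ x _ => x
  | pos _ _ x _ _ => x

def tgt : ExtRelPath s t I → V
  | zero y _ _ => y
  | pos y _ _ _ _ => y

noncomputable def dim : ExtRelPath s t I → ℕ
  | zero y x _ => Module.finrank k (corner I y x)
  | pos y γ x _ _ =>
      Module.finrank k (corner I y γ.tgt) * γ.dim * Module.finrank k (corner I γ.src x)

end ExtRelPath

/-- The set `F // W_*` of pairs `(a, ω)` of a new arrow and a parallel extended relative path. -/
def ParallelPairs : Type (max u v) :=
  {q : F × ExtRelPath s t I // s q.1 = q.2.src ∧ t q.1 = q.2.tgt}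

end RelativePaths

/-! ### First Hochschild cohomology -/

section Hochschild

variable (k : Type w) [CommRing k] (A : Type u) [Ring A] [Algebra k A]
  (M : Type v) [AddCommGroup M] [Module k M] [Module A M] [Module Aᵐᵒᵖ M]
  [IsScalarTower k A M] [IsScalarTower k Aᵐᵒᵖ M]

/-- The Hochschild differential `M → Hom_k(A, M)`, `x ↦ (a ↦ a x - x a)`, for an
`A`-bimodule `M`. The right action of `a` is written `MulOpposite.op a • x`. -/
noncomputable def hochschildD0 : M →ₗ[k] A →ₗ[k] M :=
  LinearMap.mk₂ k (fun x a => a • x - MulOpposite.op a • x)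
    (fun x y a => by simp only [smul_add]; abel)
    (fun c x a => by rw [smul_sub, smul_comm c a x, smul_comm c (MulOpposite.op a) x])
    (fun x a b => by simp only [MulOpposite.op_add, add_smul]; abel)
    (fun c x a => by simp only [MulOpposite.op_smul, smul_assoc, smul_sub])

/-- The Hochschild differential `Hom_k(A, M) → Hom_k(A ⊗ A, M)`,
`φ ↦ (a ⊗ b ↦ a φ(b) - φ(a b) + φ(a) b)`. -/
noncomputable def hochschildD1 : (A →ₗ[k] M) →ₗ[k] A →ₗ[k] A →ₗ[k] M where
  toFun φ := LinearMap.mk₂ k (fun a b => a • φ b - φ (a * b) + MulOpposite.op b • φ a)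
    (fun a a' b => by simp only [add_smul, add_mul, map_add, smul_add]; abel)
    (fun c a b => by
      simp only [smul_assoc, smul_mul_assoc, map_smul, smul_sub, smul_add]
      rw [smul_comm c (MulOpposite.op b)])
    (fun a b b' => by
      simp only [MulOpposite.op_add, add_smul, mul_add, map_add, smul_add]; abel)
    (fun c a b => by
      simp only [MulOpposite.op_smul, smul_assoc, mul_smul_comm, map_smul, smul_sub, smul_add]
      rw [smul_comm c a])
  map_add' φ ψ := by
    ext a b
    simp only [LinearMap.mk₂_apply, LinearMap.add_apply, smul_add]
    abel
  map_smul' c φ := by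
    ext a b
    simp only [LinearMap.mk₂_apply, LinearMap.smul_apply, RingHom.id_apply, smul_add, smul_sub]
    rw [smul_comm c a, smul_comm c (MulOpposite.op b)]

theorem hochschildD0_apply (x : M) (a : A) :
    hochschildD0 k A M x a = a • x - MulOpposite.op a • x := rfl

theorem hochschildD1_apply (φ : A →ₗ[k] M) (a b : A) :
    hochschildD1 k A M φ a b = a • φ b - φ (a * b) + MulOpposite.op b • φ a := rfl

theorem hochschildD1_comp_hochschildD0 [SMulCommClass A Aᵐᵒᵖ M] :
    hochschildD1 k A M ∘ₗ hochschildD0 k A M = 0 := by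
  ext x a b
  simp only [LinearMap.comp_apply, hochschildD1_apply, hochschildD0_apply, LinearMap.zero_apply,
    smul_sub, mul_smul, MulOpposite.op_mul, smul_comm a (MulOpposite.op b) x]
  abel

/-- `H¹(A, M)`: the first cohomology of the Hochschild cochain complex of `A` with coefficients
in the bimodule `M` (derivations modulo inner derivations). -/
def HochschildH1 : Type max u v :=
  LinearMap.ker (hochschildD1 k A M) ⧸
    (LinearMap.range (hochschildD0 k A M)).submoduleOf (LinearMap.ker (hochschildD1 k A M))

noncomputable instance : AddCommGroup (HochschildH1 k A M) :=
  inferInstanceAs (AddCommGroup (LinearMap.ker (hochschildD1 k A M) ⧸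
    (LinearMap.range (hochschildD0 k A M)).submoduleOf (LinearMap.ker (hochschildD1 k A M))))

noncomputable instance : Module k (HochschildH1 k A M) :=
  inferInstanceAs (Module k (LinearMap.ker (hochschildD1 k A M) ⧸
    (LinearMap.range (hochschildD0 k A M)).submoduleOf (LinearMap.ker (hochschildD1 k A M))))

/-- `HH¹(A) = H¹(A, A)` -/
abbrev HH1 : Type u := HochschildH1 k A A

end Hochschild

/-! ### Projective covers and injective envelopes -/

section Covers

/-- `P` is a projective cover of `S`: `P` is projective and there is a surjection `P → S` whose
kernel is superfluous. -/
def IsProjectiveCover (R : Type u) [Ring R] (P S : Type u) [AddCommGroup P] [Module R P]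
    [AddCommGroup S] [Module R S] : Prop :=
  Module.Projective R P ∧ ∃ π : P →ₗ[R] S, Function.Surjective π ∧
    ∀ N : Submodule R P, N ⊔ LinearMap.ker π = ⊤ → N = ⊤

/-- `E` is an injective envelope of `S`: `E` is injective and there is an injection `S → E`
whose image is essential. -/
def IsInjectiveEnvelope (R : Type u) [Ring R] (E S : Type u) [AddCommGroup E] [Module R E]
    [AddCommGroup S] [Module R S] : Prop :=
  Module.Injective R E ∧ ∃ ι : S →ₗ[R] E, Function.Injective ι ∧
    ∀ N : Submodule R E, N ⊓ LinearMap.range ι = ⊥ → N = ⊥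

variable {k : Type w} {V : Type u} [Quiver.{v} V] [Field k] [Fintype V]

/-- `S` is the simple left `B`-module at the vertex `x`, that is the simple module on which the
idempotent `x` does not act as zero. -/
def IsSimpleAt (I : TwoSidedIdeal (PathAlgebra k V)) (x : V) (S : Type*) [AddCommGroup S]
    [Module (BoundQuiverAlgebra I) S] : Prop :=
  IsSimpleModule (BoundQuiverAlgebra I) S ∧ ∃ m : S, BoundQuiverAlgebra.vertex I x • m ≠ 0

end Covers

/-! The proof compares derivations instead of cohomology groups. Since `HH¹(A)` is the cokernel of
`A → Der(A, A)`, `x ↦ [-, x]`, whose kernel is the centre, `dim HH¹(A) - dim ZA` equals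
`dim Der(A, A) - dim A` for each finite dimensional algebra `A` (`finrank_HH1`). In the same way,
a derivation of `B` in `Hom_k(M, N)` is a `B`-linear map to `N` from the kernel of `B ⊗ M → M`, and
the long exact sequence for `Ext` shows that `dim Ext¹(M, N) - dim Hom(M, N)` equals
`dim Der(B, Hom_k(M, N)) - dim M · dim N` (`finrank_ext`). For `M = I_x ≅ Hom_k(xB, k)` and
`N = P_y ≅ By` the bimodule `Hom_k(M, N)` is `By ⊗ xB` (`finrank_ext_of_equiv`).

The algebra `B_F` is the tensor algebra over `B` of the bimodule `⨁_a B t(a) ⊗ s(a) B`. Choosing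
bases of the spaces `s(a) B t(b)`, it becomes, as a `B`-bimodule, the direct sum of `B` and of
`B t(w) ⊗ s(w) B`, where `w` runs over the words made of new arrows and of basis elements between
consecutive arrows. The universal property of `B_F` gives an action of `B_F` on this model, which
shows that the map from the model to `B_F` is an isomorphism (`modelMap_bijective`). There are
`dim γ` words over each relative path `γ`; without relative cycles no arrow repeats in a word, so
there are finitely many words (`finite_wordOf`, `sum_word_eq_sum_relPath`).

The universal property also shows that each derivation of `B` in `B_F` extends to `B_F`, and that
the extensions differ by arbitrary values in `t(a) B_F s(a)` on the new arrows
(`finrank_derivations_restrict`). Hence `dim Der(B_F, B_F)` is the sum of `dim Der(B, B_F)` and of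
the `dim t(a) B_F s(a)`. The decomposition of `B_F` splits the former into `dim Der(B, B)` and the
derivations in the `B t(w) ⊗ s(w) B`, which together with `dim B_F` account for the terms with
`Ext¹` and `Hom`; and it expresses the latter by extended relative paths parallel to `a`. -/

open scoped TensorProduct

universe z

/-! ### Derivations and the first Hochschild cohomology -/

section Derivations

variable {k : Type*} [Field k] {A : Type*} [Ring A] [Algebra k A]
  {X : Type*} [AddCommGroup X] [Module k X] {Y : Type*} [AddCommGroup Y] [Module k Y]

/-- The `k`-linear derivations `A → X`, for a vector space `X` on which `A` acts on the left
through `L` and on the right through `R`. The actions are arbitrary linear maps into the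
endomorphisms of `X`, so that no bimodule instances are needed. -/
def derivations (L R : A →ₗ[k] Module.End k X) : Submodule k (A →ₗ[k] X) where
  carrier := {d | ∀ a b, d (a * b) = L a (d b) + R b (d a)}
  add_mem' {d d'} h h' a b := by
    simp only [LinearMap.add_apply, h a b, h' a b, map_add]; abel
  zero_mem' a b := by simp
  smul_mem' c d h a b := by simp [h a b]

theorem mem_derivations {L R : A →ₗ[k] Module.End k X} {d : A →ₗ[k] X} :
    d ∈ derivations L R ↔ ∀ a b, d (a * b) = L a (d b) + R b (d a) := Iff.rfl

theorem finrank_derivations_congr {L R : A →ₗ[k] Module.End k X} {L' R' : A →ₗ[k] Module.End k Y}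
    (φ : X ≃ₗ[k] Y) (hL : ∀ a x, φ (L a x) = L' a (φ x)) (hR : ∀ a x, φ (R a x) = R' a (φ x)) :
    Module.finrank k (derivations L R) = Module.finrank k (derivations L' R') := by
  refine (LinearEquiv.ofSubmodules (LinearEquiv.congrRight φ) _ _ ?_).finrank_eq
  ext d
  simp only [Submodule.mem_map, mem_derivations]
  constructor
  · rintro ⟨d, h, rfl⟩ a b
    change φ (d (a * b)) = L' a (φ (d b)) + R' b (φ (d a))
    rw [h a b, map_add, hL, hR]
  · intro h
    refine ⟨φ.symm.toLinearMap ∘ₗ d, fun a b => φ.injective ?_, ?_⟩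
    · simp [h a b, hL, hR]
    · ext a
      exact φ.apply_symm_apply (d a)

theorem finrank_derivations_prod [FiniteDimensional k A] [FiniteDimensional k X]
    [FiniteDimensional k Y] {L R : A →ₗ[k] Module.End k (X × Y)}
    {L₁ R₁ : A →ₗ[k] Module.End k X} {L₂ R₂ : A →ₗ[k] Module.End k Y}
    (hL : ∀ a x, L a x = (L₁ a x.1, L₂ a x.2)) (hR : ∀ a x, R a x = (R₁ a x.1, R₂ a x.2)) :
    Module.finrank k (derivations L R) =
      Module.finrank k (derivations L₁ R₁) + Module.finrank k (derivations L₂ R₂) := by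
  rw [← Module.finrank_prod]
  refine LinearEquiv.finrank_eq
    { toFun := fun d => (⟨LinearMap.fst k X Y ∘ₗ d.1, fun a b => by simp [d.2 a b, hL, hR]⟩,
        ⟨LinearMap.snd k X Y ∘ₗ d.1, fun a b => by simp [d.2 a b, hL, hR]⟩)
      invFun := fun d => ⟨d.1.1.prod d.2.1, fun a b => by simp [d.1.2 a b, d.2.2 a b, hL, hR]⟩
      map_add' := fun _ _ => rfl
      map_smul' := fun _ _ => rfl
      left_inv := fun _ => rfl
      right_inv := fun _ => rfl }

theorem finrank_derivations_pi [FiniteDimensional k A] {W : Type*} [Fintype W] {X : W → Type*}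
    [∀ w, AddCommGroup (X w)] [∀ w, Module k (X w)] [∀ w, FiniteDimensional k (X w)]
    {L R : A →ₗ[k] Module.End k (∀ w, X w)} {L' R' : ∀ w, A →ₗ[k] Module.End k (X w)}
    (hL : ∀ a x w, L a x w = L' w a (x w)) (hR : ∀ a x w, R a x w = R' w a (x w)) :
    Module.finrank k (derivations L R) =
      ∑ w, Module.finrank k (derivations (L' w) (R' w)) := by
  rw [← Module.finrank_pi_fintype]
  refine LinearEquiv.finrank_eq
    { toFun := fun d w => ⟨LinearMap.proj w ∘ₗ d.1, fun a b => by simp [d.2 a b, hL, hR]⟩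
      invFun := fun d => ⟨LinearMap.pi fun w => (d w).1, fun a b => by
        ext w; simp [(d w).2 a b, hL, hR]⟩
      map_add' := fun _ _ => rfl
      map_smul' := fun _ _ => rfl
      left_inv := fun _ => rfl
      right_inv := fun _ => rfl }

/-- The left regular action. -/
abbrev leftRegular (k A : Type*) [Field k] [Ring A] [Algebra k A] : A →ₗ[k] Module.End k A :=
  LinearMap.mul k A

/-- The right regular action. -/
abbrev rightRegular (k A : Type*) [Field k] [Ring A] [Algebra k A] : A →ₗ[k] Module.End k A :=
  (LinearMap.mul k A).flip

theorem finrank_quotient_submoduleOf {E : Type*} [AddCommGroup E] [Module k E]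
    [FiniteDimensional k E] {S K : Submodule k E} (h : S ≤ K) :
    Module.finrank k (K ⧸ S.submoduleOf K) + Module.finrank k S = Module.finrank k K := by
  rw [← (Submodule.submoduleOfEquivOfLe h).finrank_eq, Submodule.finrank_quotient_add_finrank]

/-- `HH¹(A)` is the space of derivations modulo the image of `A`, on which the centre is the
kernel of `x ↦ [-, x]`. -/
theorem finrank_HH1 (k : Type w) (A : Type u) [Field k] [Ring A] [Algebra k A]
    [FiniteDimensional k A] :
    (Module.finrank k (HH1 k A) : ℤ) - Module.finrank k (Subalgebra.center k A) =
      Module.finrank k (derivations (leftRegular k A) (rightRegular k A)) -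
        Module.finrank k A := by
  have h1 : LinearMap.ker (hochschildD1 k A A) =
      derivations (leftRegular k A) (rightRegular k A) := by
    ext d
    simp only [LinearMap.mem_ker, mem_derivations, LinearMap.ext_iff, hochschildD1_apply]
    refine forall_congr' fun a => forall_congr' fun b => ?_
    simp only [smul_eq_mul, MulOpposite.smul_eq_mul_unop, MulOpposite.unop_op,
      LinearMap.zero_apply, LinearMap.mul_apply', LinearMap.flip_apply]
    constructor
    · intro h
      rw [← sub_eq_zero, ← neg_eq_zero, ← h]
      abel
    · intro h
      rw [h]
      abel
  have hle : LinearMap.range (hochschildD0 k A A) ≤ LinearMap.ker (hochschildD1 k A A) := by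
    rw [LinearMap.range_le_ker_iff]
    exact hochschildD1_comp_hochschildD0 k A A
  have h2 : Module.finrank k (HH1 k A) +
      Module.finrank k (LinearMap.range (hochschildD0 k A A)) =
      Module.finrank k (LinearMap.ker (hochschildD1 k A A)) :=
    finrank_quotient_submoduleOf hle
  have h4 := LinearMap.finrank_range_add_finrank_ker (hochschildD0 k A A)
  have h5 : Module.finrank k (LinearMap.ker (hochschildD0 k A A)) =
      Module.finrank k (Subalgebra.center k A) := by
    have : LinearMap.ker (hochschildD0 k A A) =
        Subalgebra.toSubmodule (Subalgebra.center k A) := by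
      ext z
      simp only [LinearMap.mem_ker, LinearMap.ext_iff, hochschildD0_apply, smul_eq_mul,
        MulOpposite.smul_eq_mul_unop, MulOpposite.unop_op, LinearMap.zero_apply, sub_eq_zero,
        Subalgebra.mem_toSubmodule, Subalgebra.mem_center_iff]
    rw [this]
    rfl
  rw [h1] at h2
  rw [h5] at h4
  rw [← h2, ← h4]
  push_cast
  ring

end Derivations

/-! ### One-sided ideals of idempotents -/

section OneSidedIdeals

variable {B : Type*} [Ring B]

/-- The left ideal `Be`, for an idempotent `e`: the elements `b` with `be = b`. -/
def leftIdeal (e : B) : Submodule B B :=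
  LinearMap.eqLocus (LinearMap.toSpanSingleton B B e) LinearMap.id

/-- The right ideal `eB`, for an idempotent `e`: the elements `b` with `eb = b`. -/
def rightIdeal (e : B) : Submodule Bᵐᵒᵖ B where
  carrier := {b | e * b = b}
  add_mem' {b b'} (h : e * b = b) (h' : e * b' = b') := by
    simp [mul_add, h, h']
  zero_mem' := by simp
  smul_mem' c b (h : e * b = b) := by
    simp [MulOpposite.smul_eq_mul_unop, ← mul_assoc, h]

theorem mem_leftIdeal {e b : B} : b ∈ leftIdeal e ↔ b * e = b := Iff.rfl

theorem mem_rightIdeal {e b : B} : b ∈ rightIdeal e ↔ e * b = b := Iff.rfl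

variable (k : Type*) [Field k] [Algebra k B]

/-- The space `yBx`. -/
noncomputable def cornerSpace (y x : B) : Submodule k B :=
  LinearMap.range (LinearMap.mulLeftRight k (y, x))

variable {k}

theorem mem_cornerSpace {y x z : B} (hy : IsIdempotentElem y) (hx : IsIdempotentElem x) :
    z ∈ cornerSpace k y x ↔ y * z = z ∧ z * x = z := by
  constructor
  · rintro ⟨c, rfl⟩
    simp only [LinearMap.mulLeftRight_apply]
    constructor
    · rw [← mul_assoc, ← mul_assoc, hy.eq]
    · rw [mul_assoc, hx.eq]
  · rintro ⟨h, h'⟩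
    exact ⟨z, by simp [h, h']⟩

/-- Multiplication on the left by `y`, as a map `Bx → yBx`. -/
noncomputable def cutLeft (y x : B) : leftIdeal x →ₗ[k] cornerSpace k y x where
  toFun b := ⟨y * b, b, by simp [mul_assoc, mem_leftIdeal.1 b.2]⟩
  map_add' b b' := by ext; simp [mul_add]
  map_smul' c b := by ext; simp

variable (k)

/-- The right action of `B` on `By ⊗ xB`. -/
noncomputable def tensorRight (y x : B) :
    B →ₗ[k] Module.End k (leftIdeal y ⊗[k] rightIdeal x) :=
  LinearMap.lTensorHom (leftIdeal y) ∘ₗ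
    (Algebra.lsmul k k (rightIdeal x) : Bᵐᵒᵖ →ₐ[k] _).toLinearMap ∘ₗ
    (MulOpposite.opLinearEquiv k : B ≃ₗ[k] Bᵐᵒᵖ).toLinearMap

/-- The left action of `B` on `By ⊗ xB`. -/
noncomputable def tensorLeft (y x : B) :
    B →ₗ[k] Module.End k (leftIdeal y ⊗[k] rightIdeal x) :=
  (Algebra.lsmul k k (leftIdeal y ⊗[k] rightIdeal x) : B →ₐ[k] _).toLinearMap

end OneSidedIdeals

/-! ### Words of arrows and the model of the tensor algebra -/

section Words

/-- The sequences `(a_n, i_{n-1}, a_{n-1}, …, i_1, a_1)` with `a_1 = a` and `a_n = b` of elements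
of `F` and of indices `i_j < d a_{j+1} a_j`. -/
inductive WordPath {F : Type*} (d : F → F → ℕ) (a : F) : F → Type _
  | nil : WordPath d a a
  | cons {b c : F} (p : WordPath d a b) (i : Fin (d c b)) : WordPath d a c

/-- A sequence as in `WordPath`, with arbitrary ends. -/
structure WordOf {F : Type*} (d : F → F → ℕ) where
  src : F
  tgt : F
  path : WordPath d src tgt

variable (k : Type*) [Field k] {B : Type*} [Ring B] [Algebra k B] {F : Type*} (σ τ : F → B)

/-- The dimensions of the spaces `s(a) B t(b)`, for new arrows `a` and `b`. -/
noncomputable def cornerDim (a b : F) : ℕ := Module.finrank k (cornerSpace k (σ a) (τ b))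

/-- A word is a sequence `(a_n, i_{n-1}, a_{n-1}, …, i_1, a_1)` of new arrows `a_j` and of indices
`i_j` of elements of a basis of `s(a_{j+1}) B t(a_j)`. -/
abbrev Word := WordOf (cornerDim k σ τ)

variable {σ τ}

/-- Extension of a word by a new arrow. -/
abbrev Word.cons (w : Word k σ τ) {a : F} (i : Fin (cornerDim k σ τ a w.tgt)) :
    Word k σ τ :=
  ⟨w.src, a, w.path.cons i⟩

/-- The word of length one. -/
abbrev Word.single (a : F) : Word k σ τ := ⟨a, a, .nil⟩

variable (σ τ) in
/-- The `B`-bimodule `B t(w) ⊗ s(w) B` of a word. -/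
abbrev Word.Bimod (w : Word k σ τ) : Type _ := leftIdeal (τ w.tgt) ⊗[k] rightIdeal (σ w.src)

variable (σ τ) in
/-- The `B`-bimodule `B ⊕ ⨁_w B t(w) ⊗ s(w) B`, a model for the tensor algebra of the bimodule
`⨁_a B t(a) ⊗ s(a) B` with coordinates in the middle corners. -/
abbrev TensorModel : Type _ := B × ∀ w : Word k σ τ, w.Bimod k σ τ

variable (σ τ) in
/-- The right action of `B` on the model. -/
noncomputable def TensorModel.right : B →ₗ[k] Module.End k (TensorModel k σ τ) where
  toFun b := LinearMap.prodMap (LinearMap.mulRight k b)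
    (LinearMap.pi fun w => tensorRight k _ _ b ∘ₗ LinearMap.proj w)
  map_add' b c := by
    refine LinearMap.ext fun m => Prod.ext ?_ (funext fun w => ?_)
    · simp [mul_add]
    · simp
  map_smul' c b := by
    refine LinearMap.ext fun m => Prod.ext ?_ (funext fun w => ?_)
    · simp
    · simp

variable [FiniteDimensional k B]

/-- The chosen basis of `s(a) B t(b)`. -/
noncomputable def cornerBasis (a b : F) :
    Module.Basis (Fin (cornerDim k σ τ a b)) k (cornerSpace k (σ a) (τ b)) :=
  Module.finBasis k (cornerSpace k (σ a) (τ b))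

variable {k} {T : Type*} [Ring T] [Algebra k T] (ι : B →ₐ[k] T) (arr : F → T)

/-- The element `a_n e_{i_{n-1}} a_{n-1} ⋯ e_{i_1} a_1` attached to a word. -/
noncomputable def wordElt : ∀ {a b : F}, WordPath (cornerDim k σ τ) a b → T
  | a, _, .nil => arr a
  | _, c, .cons (b := b) p i => arr c * ι (cornerBasis k (σ := σ) (τ := τ) c b i) * wordElt p

/-- The map `B t(w) ⊗ s(w) B → T` sending `b ⊗ c` to `b w c`. -/
noncomputable def wordMap (w : Word k σ τ) : w.Bimod k σ τ →ₗ[k] T :=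
  TensorProduct.lift <| LinearMap.mk₂ k
    (fun (p : leftIdeal (τ w.tgt)) (r : rightIdeal (σ w.src)) =>
      ι p * wordElt ι arr w.path * ι r)
    (fun _ _ _ => by simp [add_mul]) (fun _ _ _ => by simp)
    (fun _ _ _ => by simp [mul_add]) (fun _ _ _ => by simp)

/-- The map from the model to the algebra `T`. -/
noncomputable def modelMap [Fintype (Word k σ τ)] : TensorModel k σ τ →ₗ[k] T :=
  LinearMap.coprod ι.toLinearMap (∑ w, wordMap ι arr w ∘ₗ LinearMap.proj w)

end Words

/-! ### The action of the arrows on the model -/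

section ArrowOperators

variable {k : Type*} [Field k] {B : Type*} [Ring B] [Algebra k B] {F : Type*} {σ τ : F → B}

/-- The generator `e` of `Be`. -/
def leftIdeal.gen {e : B} (h : IsIdempotentElem e) : leftIdeal e := ⟨e, h⟩

variable (k) in
/-- Multiplication on the left by `e`, as a map `B → eB`. -/
noncomputable def cutRight {e : B} (h : IsIdempotentElem e) : B →ₗ[k] rightIdeal e where
  toFun b := ⟨e * b, by rw [mem_rightIdeal, ← mul_assoc, h.eq]⟩
  map_add' b b' := by ext; simp [mul_add]
  map_smul' c b := by ext; simp

theorem cutRight_coe {e : B} (h : IsIdempotentElem e) (r : rightIdeal e) :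
    cutRight k h (r : B) = r := Subtype.ext r.2

variable [FiniteDimensional k B]

/-- The component of the left action of an arrow `a` on the model that goes from the word `w` to
its extension by `a` and the basis index `i`. -/
noncomputable def extendWord (hτ : ∀ a, IsIdempotentElem (τ a)) (w : Word k σ τ)
    {a : F} (i : Fin (cornerDim k σ τ a w.tgt)) :
    w.Bimod k σ τ →ₗ[k] (w.cons k i).Bimod k σ τ :=
  LinearMap.rTensor (rightIdeal (σ w.src))
    (((cornerBasis k a w.tgt).coord i ∘ₗ cutLeft (σ a) (τ w.tgt)).smulRight
      (leftIdeal.gen (hτ a)))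

theorem extendWord_tmul (hτ : ∀ a, IsIdempotentElem (τ a)) (w : Word k σ τ)
    {a : F} (i : Fin (cornerDim k σ τ a w.tgt)) (p : leftIdeal (τ w.tgt))
    (r : rightIdeal (σ w.src)) :
    extendWord hτ w i (p ⊗ₜ r) = ((cornerBasis k a w.tgt).repr (cutLeft (σ a) (τ w.tgt) p) i •
      leftIdeal.gen (hτ a)) ⊗ₜ[k] r := rfl

variable [Fintype (Word k σ τ)]

open Classical in
/-- The left action of an arrow on the model. -/
noncomputable def arrowOp (hσ : ∀ a, IsIdempotentElem (σ a)) (hτ : ∀ a, IsIdempotentElem (τ a))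
    (a : F) : Module.End k (TensorModel k σ τ) :=
  LinearMap.inr k B (∀ w : Word k σ τ, w.Bimod k σ τ) ∘ₗ
    (LinearMap.single k (fun w : Word k σ τ => w.Bimod k σ τ) (Word.single k a) ∘ₗ
      (TensorProduct.mk k _ _ (leftIdeal.gen (hτ a)) ∘ₗ cutRight k (hσ a)) ∘ₗ
      LinearMap.fst k B (∀ w : Word k σ τ, w.Bimod k σ τ) +
    ∑ w : Word k σ τ, ∑ i : Fin (cornerDim k σ τ a w.tgt),
      LinearMap.single k (fun w : Word k σ τ => w.Bimod k σ τ) (w.cons k (a := a) i) ∘ₗ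
        extendWord hτ w (a := a) i ∘ₗ LinearMap.proj w ∘ₗ
        LinearMap.snd k B (∀ w : Word k σ τ, w.Bimod k σ τ))

variable (hσ : ∀ a, IsIdempotentElem (σ a)) (hτ : ∀ a, IsIdempotentElem (τ a))

open Classical in
theorem arrowOp_base (a : F) (b : B) : arrowOp (k := k) hσ hτ a (b, 0) =
    (0, Pi.single (M := fun w : Word k σ τ => w.Bimod k σ τ) (Word.single k a)
      (leftIdeal.gen (hτ a) ⊗ₜ cutRight k (hσ a) b)) := by
  simp [arrowOp]

open Classical in
theorem arrowOp_single (a : F) (w : Word k σ τ) (x : w.Bimod k σ τ) :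
    arrowOp (k := k) hσ hτ a (0, Pi.single w x) =
    (0, ∑ i : Fin (cornerDim k σ τ a w.tgt),
      Pi.single (M := fun w : Word k σ τ => w.Bimod k σ τ) (w.cons k (a := a) i)
        (extendWord hτ w (a := a) i x)) := by
  simp only [arrowOp, LinearMap.comp_apply, LinearMap.add_apply, LinearMap.sum_apply,
    LinearMap.fst_apply, LinearMap.snd_apply, LinearMap.proj_apply, LinearMap.inr_apply,
    map_zero, zero_add, LinearMap.coe_single]
  congr 1
  rw [Finset.sum_eq_single w]
  · simp
  · intro w' _ hne
    simp [Pi.single_eq_of_ne hne]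
  · simp

omit [FiniteDimensional k B] in
open Classical in
theorem TensorModel.hom_ext {Y : Type*} [AddCommGroup Y] [Module k Y]
    {f g : TensorModel k σ τ →ₗ[k] Y} (h0 : ∀ b, f (b, 0) = g (b, 0))
    (h1 : ∀ (w : Word k σ τ) (p : leftIdeal (τ w.tgt)) (r : rightIdeal (σ w.src)),
      f (0, Pi.single w (p ⊗ₜ r)) = g (0, Pi.single w (p ⊗ₜ r))) : f = g := by
  refine LinearMap.prod_ext (LinearMap.ext h0) (LinearMap.pi_ext' fun w => ?_)
  exact TensorProduct.ext' fun p r => h1 w p r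

theorem smul_arrowOp (a : F) (m : TensorModel k σ τ) :
    τ a • arrowOp hσ hτ a m = arrowOp hσ hτ a m := by
  classical
  have : Algebra.lsmul k k (TensorModel k σ τ) (τ a) * arrowOp hσ hτ a = arrowOp hσ hτ a := by
    have h : τ a • leftIdeal.gen (hτ a) = leftIdeal.gen (hτ a) := Subtype.ext (hτ a)
    refine TensorModel.hom_ext (fun b => ?_) (fun w p r => ?_)
    · simp only [Module.End.mul_apply, Algebra.lsmul_coe, arrowOp_base, Prod.smul_mk, smul_zero]
      rw [← Pi.single_smul, TensorProduct.smul_tmul', h]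
    · simp only [Module.End.mul_apply, Algebra.lsmul_coe, arrowOp_single, Prod.smul_mk, smul_zero]
      rw [Finset.smul_sum]
      congr 1
      refine Finset.sum_congr rfl fun i _ => ?_
      rw [← Pi.single_smul, extendWord_tmul, TensorProduct.smul_tmul', smul_comm, h]
  exact LinearMap.congr_fun this m

theorem arrowOp_smul (a : F) (m : TensorModel k σ τ) :
    arrowOp hσ hτ a (σ a • m) = arrowOp hσ hτ a m := by
  classical
  have : arrowOp hσ hτ a * Algebra.lsmul k k (TensorModel k σ τ) (σ a) = arrowOp hσ hτ a := by
    refine TensorModel.hom_ext (fun b => ?_) (fun w p r => ?_)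
    · simp only [Module.End.mul_apply, Algebra.lsmul_coe, Prod.smul_mk, smul_zero]
      have h : cutRight k (hσ a) (σ a • b) = cutRight k (hσ a) b :=
        Subtype.ext (by simp [cutRight, ← mul_assoc, (hσ a).eq])
      rw [arrowOp_base, arrowOp_base, h]
    · simp only [Module.End.mul_apply, Algebra.lsmul_coe, Prod.smul_mk, smul_zero]
      have h : cutLeft (k := k) (σ a) (τ w.tgt) (σ a • p) = cutLeft (σ a) (τ w.tgt) p :=
        Subtype.ext (by simp [cutLeft, ← mul_assoc, (hσ a).eq])
      rw [← Pi.single_smul, arrowOp_single, arrowOp_single]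
      congr 1
      refine Finset.sum_congr rfl fun i _ => ?_
      rw [TensorProduct.smul_tmul', extendWord_tmul, extendWord_tmul, h]
  exact LinearMap.congr_fun this m

end ArrowOperators

/-! ### The isomorphism with the model -/

section ModelMap

variable {k : Type*} [Field k] {B : Type*} [Ring B] [Algebra k B] [FiniteDimensional k B]
  {F : Type*} {σ τ : F → B} {T : Type*} [Ring T] [Algebra k T] {ι : B →ₐ[k] T} {arr : F → T}

theorem wordMap_tmul (w : Word k σ τ) (p : leftIdeal (τ w.tgt)) (r : rightIdeal (σ w.src)) :
    wordMap ι arr w (p ⊗ₜ r) = ι p * wordElt ι arr w.path * ι r := rfl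

variable [Fintype (Word k σ τ)]

theorem modelMap_base (b : B) : modelMap (σ := σ) (τ := τ) ι arr (b, 0) = ι b := by
  simp [modelMap]

open Classical in
theorem modelMap_single (w : Word k σ τ) (x : w.Bimod k σ τ) :
    modelMap ι arr (0, Pi.single w x) = wordMap ι arr w x := by
  simp only [modelMap, LinearMap.coprod_apply, map_zero, zero_add, LinearMap.sum_apply,
    LinearMap.comp_apply, LinearMap.proj_apply]
  rw [Finset.sum_eq_single w]
  · simp
  · intro w' _ hne
    simp [Pi.single_eq_of_ne hne]
  · simp

theorem modelMap_smul (b : B) (m : TensorModel k σ τ) :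
    modelMap ι arr (b • m) = ι b * modelMap ι arr m := by
  classical
  have : modelMap ι arr ∘ₗ Algebra.lsmul k k (TensorModel k σ τ) b =
      LinearMap.mulLeft k (ι b) ∘ₗ modelMap ι arr := by
    refine TensorModel.hom_ext (fun c => ?_) (fun w p r => ?_)
    · simp [modelMap_base]
    · simp only [LinearMap.comp_apply, Algebra.lsmul_coe, Prod.smul_mk, smul_zero,
        ← Pi.single_smul, modelMap_single, TensorProduct.smul_tmul', wordMap_tmul,
        LinearMap.mulLeft_apply]
      simp [mul_assoc]
  exact LinearMap.congr_fun this m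

theorem modelMap_right (b : B) (m : TensorModel k σ τ) :
    modelMap ι arr (TensorModel.right k σ τ b m) = modelMap ι arr m * ι b := by
  classical
  have : modelMap ι arr ∘ₗ TensorModel.right k σ τ b =
      LinearMap.mulRight k (ι b) ∘ₗ modelMap ι arr := by
    refine TensorModel.hom_ext (fun c => ?_) (fun w p r => ?_)
    · have : TensorModel.right k σ τ b (c, 0) = (c * b, 0) :=
        Prod.ext rfl (funext fun w => map_zero (tensorRight k _ _ b))
      simp [modelMap_base, this]
    · have : TensorModel.right k σ τ b (0, Pi.single w (p ⊗ₜ r)) =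
          (0, Pi.single w (p ⊗ₜ (MulOpposite.op b • r))) := by
        refine Prod.ext (zero_mul b) (funext fun w' => ?_)
        change tensorRight k _ _ b _ = _
        by_cases h : w' = w
        · subst h
          simp only [LinearMap.proj_apply, LinearMap.snd_apply, Pi.single_eq_same]
          rfl
        · simp only [LinearMap.proj_apply, LinearMap.snd_apply, Pi.single_eq_of_ne h, map_zero]
      simp only [LinearMap.comp_apply, this, modelMap_single, wordMap_tmul,
        LinearMap.mulRight_apply]
      simp [mul_assoc]
  exact LinearMap.congr_fun this m

variable (hσ : ∀ a, IsIdempotentElem (σ a)) (hτ : ∀ a, IsIdempotentElem (τ a))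
  (hl : ∀ a, ι (τ a) * arr a = arr a) (hr : ∀ a, arr a * ι (σ a) = arr a)
include hl hr

theorem modelMap_arrowOp (a : F) (m : TensorModel k σ τ) :
    modelMap ι arr (arrowOp hσ hτ a m) = arr a * modelMap ι arr m := by
  classical
  have : modelMap ι arr ∘ₗ arrowOp hσ hτ a = LinearMap.mulLeft k (arr a) ∘ₗ modelMap ι arr := by
    refine TensorModel.hom_ext (fun c => ?_) (fun w p r => ?_)
    · simp only [LinearMap.comp_apply, arrowOp_base, modelMap_single, wordMap_tmul,
        LinearMap.mulLeft_apply, modelMap_base]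
      simp only [leftIdeal.gen, wordElt, cutRight, LinearMap.coe_mk, AddHom.coe_mk, map_mul]
      rw [hl, ← mul_assoc, hr]
    · have hp : ι (σ a) * ι p = ∑ i : Fin (cornerDim k σ τ a w.tgt),
          (cornerBasis k a w.tgt).repr (cutLeft (σ a) (τ w.tgt) p) i •
            ι (cornerBasis k (σ := σ) (τ := τ) a w.tgt i) := by
        have := congrArg (fun z : cornerSpace k (σ a) (τ w.tgt) => ι (z : B))
          ((cornerBasis k a w.tgt).sum_repr (cutLeft (σ a) (τ w.tgt) p))
        simp only [Submodule.coe_sum, Submodule.coe_smul, map_sum, map_smul] at this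
        rw [this, ← map_mul]
        rfl
      have ht : ∀ (c : k), ι ((c • leftIdeal.gen (hτ a) : leftIdeal (τ a)) : B) * arr a =
          c • arr a := fun c => by
        simp [leftIdeal.gen, hl]
      have h0 : ((0 : B), ∑ i : Fin (cornerDim k σ τ a w.tgt),
          Pi.single (M := fun w : Word k σ τ => w.Bimod k σ τ) (w.cons k (a := a) i)
            (extendWord hτ w (a := a) i (p ⊗ₜ r))) =
          ∑ i : Fin (cornerDim k σ τ a w.tgt), ((0 : B),
          Pi.single (M := fun w : Word k σ τ => w.Bimod k σ τ) (w.cons k (a := a) i)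
            (extendWord hτ w (a := a) i (p ⊗ₜ r))) := by
        rw [Prod.ext_iff, Prod.fst_sum, Prod.snd_sum]; simp
      rw [LinearMap.comp_apply, arrowOp_single, h0]
      simp only [LinearMap.comp_apply, map_sum, modelMap_single,
        LinearMap.mulLeft_apply, wordMap_tmul, extendWord_tmul]
      rw [← hr a, mul_assoc (arr a), ← mul_assoc (ι (σ a)), ← mul_assoc (ι (σ a)), hp]
      simp only [Finset.mul_sum, Finset.sum_mul]
      refine Finset.sum_congr rfl fun i _ => ?_
      simp only [wordElt, ← mul_assoc, ht, smul_mul_assoc, mul_smul_comm]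
  exact LinearMap.congr_fun this m

/-- The model is isomorphic to `T` if `T` is generated by `B` and the arrows and if it acts on the
model. The inverse of the map `model → T` is `z ↦ z · 1`. -/
theorem modelMap_bijective (hadj : Algebra.adjoin k (Set.range ι ∪ Set.range arr) = ⊤)
    (ρ : T →ₐ[k] Module.End k (TensorModel k σ τ))
    (hρ : ∀ b m, ρ (ι b) m = b • m) (hρ' : ∀ a, ρ (arr a) = arrowOp hσ hτ a) :
    Function.Bijective (modelMap (σ := σ) (τ := τ) ι arr) := by
  classical
  constructor
  · have key : ∀ {a b : F} (p : WordPath (cornerDim k σ τ) a b)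
        (r : rightIdeal (σ a)), ρ (wordElt ι arr p) ((r : B), 0) =
          ((0 : B), Pi.single (M := fun w : Word k σ τ => w.Bimod k σ τ) ⟨a, b, p⟩
            (leftIdeal.gen (hτ b) ⊗ₜ r)) := by
      intro a b p r
      induction p with
      | nil => rw [wordElt, hρ', arrowOp_base, cutRight_coe]
      | @cons b c p i ih =>
        rw [wordElt, map_mul, map_mul, Module.End.mul_apply, Module.End.mul_apply, ih, hρ, hρ',
          Prod.smul_mk, smul_zero, ← Pi.single_smul, TensorProduct.smul_tmul', arrowOp_single]
        congr 1
        have hc : cutLeft (σ c) (τ b) ((cornerBasis k (σ := σ) (τ := τ) c b i : B) •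
            leftIdeal.gen (hτ b)) = cornerBasis k (σ := σ) (τ := τ) c b i := by
          have h := (mem_cornerSpace (hσ c) (hτ b)).1
            (cornerBasis k (σ := σ) (τ := τ) c b i).2
          ext
          simp only [cutLeft, leftIdeal.gen, LinearMap.coe_mk, AddHom.coe_mk,
            Submodule.coe_smul, smul_eq_mul, h.2, h.1]
        rw [Finset.sum_eq_single i]
        · rw [extendWord_tmul, hc, Module.Basis.repr_self, Finsupp.single_eq_same, one_smul]
        · intro j _ hj
          rw [extendWord_tmul, hc, Module.Basis.repr_self, Finsupp.single_eq_of_ne hj, zero_smul,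
            TensorProduct.zero_tmul, Pi.single_zero]
        · simp
    have hinv : (LinearMap.applyₗ ((1 : B), 0) ∘ₗ ρ.toLinearMap) ∘ₗ
        modelMap (σ := σ) (τ := τ) ι arr = LinearMap.id := by
      refine TensorModel.hom_ext (fun b => ?_) (fun w p r => ?_)
      · simp [modelMap_base, hρ]
      · have h1 : ρ (ι (r : B)) ((1 : B), 0) = ((r : B), 0) := by rw [hρ]; simp
        have h2 : (p : B) • leftIdeal.gen (hτ w.tgt) = p := Subtype.ext p.2
        simp only [LinearMap.comp_apply, modelMap_single, wordMap_tmul, AlgHom.toLinearMap_apply,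
          LinearMap.applyₗ_apply_apply, map_mul, Module.End.mul_apply, h1, LinearMap.id_apply]
        rw [key w.path r, hρ, Prod.smul_mk, smul_zero, ← Pi.single_smul,
          TensorProduct.smul_tmul', h2]
    exact Function.LeftInverse.injective
      (g := LinearMap.applyₗ ((1 : B), 0) ∘ₗ ρ.toLinearMap) (LinearMap.congr_fun hinv)
  · have hstab : ∀ z : T, ∀ m : TensorModel k σ τ, ∃ m', modelMap (σ := σ) (τ := τ) ι arr m' =
        z * modelMap ι arr m := by
      intro z
      have hz : z ∈ Algebra.adjoin k (Set.range ι ∪ Set.range arr) := by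
        rw [hadj]; exact Algebra.mem_top
      induction hz using Algebra.adjoin_induction with
      | mem z hz =>
        rcases hz with ⟨b, rfl⟩ | ⟨a, rfl⟩
        · exact fun m => ⟨_, modelMap_smul b m⟩
        · exact fun m => ⟨_, modelMap_arrowOp hσ hτ hl hr a m⟩
      | algebraMap c =>
        exact fun m => ⟨c • m, by rw [map_smul, Algebra.smul_def]⟩
      | add y z _ _ hy hz =>
        intro m
        obtain ⟨m₁, h₁⟩ := hy m
        obtain ⟨m₂, h₂⟩ := hz m
        exact ⟨m₁ + m₂, by rw [map_add, h₁, h₂, add_mul]⟩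
      | mul y z _ _ hy hz =>
        intro m
        obtain ⟨m₁, h₁⟩ := hz m
        obtain ⟨m₂, h₂⟩ := hy m₁
        exact ⟨m₂, by rw [h₂, h₁, mul_assoc]⟩
    intro z
    obtain ⟨m, hm⟩ := hstab z (1, 0)
    exact ⟨m, by rw [hm, modelMap_base, map_one, mul_one]⟩

end ModelMap

/-! ### Restriction of derivations to the base algebra -/

section Restriction

variable {k : Type*} [Field k] {B T : Type*} [Ring B] [Algebra k B] [Ring T] [Algebra k T]
  {F : Type*} {σ τ : F → B} {ι : B →ₐ[k] T} {arr : F → T}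

theorem derivations_map_one {L R : B →ₗ[k] Module.End k T} {d : B →ₗ[k] T}
    (hd : d ∈ derivations L R) (hL : L 1 = 1) (hR : R 1 = 1) : d 1 = 0 := by
  have := hd 1 1
  simpa [hL, hR] using this

/-- The algebra map `b ↦ (ι b, d b)` into the trivial square zero extension attached to a
derivation `d`. -/
noncomputable def derivationHom {d : B →ₗ[k] T}
    (hd : d ∈ derivations (leftRegular k T ∘ₗ ι.toLinearMap) (rightRegular k T ∘ₗ ι.toLinearMap)) :
    B →ₐ[k] TrivSqZeroExt T T :=
  AlgHom.ofLinearMap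
    { toFun := fun b => TrivSqZeroExt.inl (ι b) + TrivSqZeroExt.inr (d b)
      map_add' := fun b c => by ext <;> simp
      map_smul' := fun c b => by ext <;> simp }
    (by
      have : d 1 = 0 := derivations_map_one hd (by ext; simp) (by ext; simp)
      ext <;> simp [this])
    (fun b c => by
      have := hd b c
      ext <;> simp_all)

theorem fst_derivationHom {d : B →ₗ[k] T} (hd) (b : B) :
    (derivationHom (ι := ι) (d := d) hd b).fst = ι b := by simp [derivationHom]

theorem snd_derivationHom {d : B →ₗ[k] T} (hd) (b : B) :
    (derivationHom (ι := ι) (d := d) hd b).snd = d b := by simp [derivationHom]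

variable (hσ : ∀ a, IsIdempotentElem (σ a)) (hτ : ∀ a, IsIdempotentElem (τ a))
  (hl : ∀ a, ι (τ a) * arr a = arr a) (hr : ∀ a, arr a * ι (σ a) = arr a)
  (hadj : Algebra.adjoin k (Set.range ι ∪ Set.range arr) = ⊤)

include hadj in
/-- A derivation of `T` is determined by its values on `B` and on the arrows. -/
theorem derivation_eq_zero {d : T →ₗ[k] T}
    (hd : d ∈ derivations (leftRegular k T) (rightRegular k T))
    (h1 : ∀ b, d (ι b) = 0) (h2 : ∀ a, d (arr a) = 0) : d = 0 := by
  ext z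
  have hz : z ∈ Algebra.adjoin k (Set.range ι ∪ Set.range arr) := by
    rw [hadj]; exact Algebra.mem_top
  induction hz using Algebra.adjoin_induction with
  | mem z hz =>
    rcases hz with ⟨b, rfl⟩ | ⟨a, rfl⟩
    · exact h1 b
    · exact h2 a
  | algebraMap c => simpa using h1 (algebraMap k B c)
  | add y z _ _ hy hz => simp_all
  | mul y z _ _ hy hz => rw [hd y z, hy, hz]; simp

include hσ hτ hl hr hadj in
/-- The universal property of `T` provides derivations of `T` with prescribed restriction to `B`
and, up to a correction that vanishes if the restriction does, with prescribed values on the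
arrows. -/
theorem exists_derivation
    (hlift : ∀ (f : B →ₐ[k] TrivSqZeroExt T T) (n : F → TrivSqZeroExt T T),
      (∀ a, f (τ a) * n a = n a) → (∀ a, n a * f (σ a) = n a) →
      ∃ g : T →ₐ[k] TrivSqZeroExt T T, (∀ b, g (ι b) = f b) ∧ ∀ a, g (arr a) = n a)
    {d : B →ₗ[k] T}
    (hd : d ∈ derivations (leftRegular k T ∘ₗ ι.toLinearMap) (rightRegular k T ∘ₗ ι.toLinearMap))
    (y : F → T) :
    ∃ D ∈ derivations (leftRegular k T) (rightRegular k T), (∀ b, D (ι b) = d b) ∧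
      ∀ a, D (arr a) = ι (τ a) * y a * ι (σ a) + d (τ a) * arr a + arr a * d (σ a) := by
  obtain ⟨g, hg, hg'⟩ := hlift (derivationHom hd)
    (fun a => derivationHom hd (τ a) * (TrivSqZeroExt.inl (arr a) + TrivSqZeroExt.inr (y a)) *
      derivationHom hd (σ a))
    (fun a => by rw [← mul_assoc, ← mul_assoc, ← map_mul, (hτ a).eq])
    (fun a => by rw [mul_assoc, ← map_mul, (hσ a).eq])
  have hfst : ∀ z, (g z).fst = z := by
    intro z
    have hz : z ∈ Algebra.adjoin k (Set.range ι ∪ Set.range arr) := by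
      rw [hadj]; exact Algebra.mem_top
    induction hz using Algebra.adjoin_induction with
    | mem z hz =>
      rcases hz with ⟨b, rfl⟩ | ⟨a, rfl⟩
      · rw [hg, fst_derivationHom]
      · rw [hg']
        simp [fst_derivationHom, hl, hr]
    | algebraMap c => rw [AlgHom.commutes]; rfl
    | add y z _ _ hy hz => rw [map_add, TrivSqZeroExt.fst_add, hy, hz]
    | mul y z _ _ hy hz => rw [map_mul, TrivSqZeroExt.fst_mul, hy, hz]
  refine ⟨{ toFun := fun z => (g z).snd
            map_add' := fun y z => by simp
            map_smul' := fun c z => by simp }, fun y z => ?_, fun b => ?_, fun a => ?_⟩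
  · simp [hfst]
  · simp [hg, snd_derivationHom]
  · simp only [LinearMap.coe_mk, AddHom.coe_mk, hg']
    simp [fst_derivationHom, snd_derivationHom, hr, mul_add, add_mul, mul_assoc]
    rw [← mul_assoc (ι (τ a)) (arr a), hl]
    abel

theorem finrank_eq_of_surjective_of_ker {E E' Z : Type*} [AddCommGroup E] [Module k E]
    [AddCommGroup E'] [Module k E'] [AddCommGroup Z] [Module k Z] [FiniteDimensional k E]
    {K : Submodule k E} {K' : Submodule k E'} (f : K →ₗ[k] K') (hf : Function.Surjective f)
    (g : LinearMap.ker f →ₗ[k] Z) (hg : Function.Bijective g) :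
    Module.finrank k K = Module.finrank k K' + Module.finrank k Z := by
  rw [← LinearMap.finrank_range_add_finrank_ker f, LinearMap.range_eq_top.2 hf, finrank_top,
    (LinearEquiv.ofBijective g hg).finrank_eq]

include hσ hτ hl hr hadj in
/-- The restriction of derivations of `T` to `B` is surjective, and its kernel is the space of
the bimodule maps from `⨁_a B t(a) ⊗ s(a) B` to `T`. -/
theorem finrank_derivations_restrict [FiniteDimensional k B] [FiniteDimensional k T] [Fintype F]
    (hlift : ∀ (f : B →ₐ[k] TrivSqZeroExt T T) (n : F → TrivSqZeroExt T T),
      (∀ a, f (τ a) * n a = n a) → (∀ a, n a * f (σ a) = n a) →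
      ∃ g : T →ₐ[k] TrivSqZeroExt T T, (∀ b, g (ι b) = f b) ∧ ∀ a, g (arr a) = n a) :
    Module.finrank k (derivations (leftRegular k T) (rightRegular k T)) =
      Module.finrank k (derivations (leftRegular k T ∘ₗ ι.toLinearMap)
        (rightRegular k T ∘ₗ ι.toLinearMap)) +
      ∑ a, Module.finrank k (cornerSpace k (ι (τ a)) (ι (σ a))) := by
  let res : derivations (leftRegular k T) (rightRegular k T) →ₗ[k]
      derivations (leftRegular k T ∘ₗ ι.toLinearMap) (rightRegular k T ∘ₗ ι.toLinearMap) :=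
    { toFun := fun D => ⟨D.1 ∘ₗ ι.toLinearMap, fun b c => by
        have := D.2 (ι b) (ι c)
        simpa using this⟩
      map_add' := fun _ _ => rfl
      map_smul' := fun _ _ => rfl }
  have hres : Function.Surjective res := fun d => by
    obtain ⟨D, hD, h, -⟩ := exists_derivation hσ hτ hl hr hadj hlift d.2 0
    exact ⟨⟨D, hD⟩, Subtype.ext (LinearMap.ext h)⟩
  have hker : ∀ D ∈ LinearMap.ker res, ∀ b, D.1 (ι b) = 0 := fun D hD b =>
    LinearMap.congr_fun (congrArg Subtype.val (LinearMap.mem_ker.1 hD)) b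
  let ev : LinearMap.ker res →ₗ[k] ∀ a, cornerSpace k (ι (τ a)) (ι (σ a)) :=
    { toFun := fun D a => ⟨D.1.1 (arr a), by
        have h1 := D.1.2 (ι (τ a)) (arr a)
        have h2 := D.1.2 (arr a) (ι (σ a))
        rw [hl, hker D.1 D.2] at h1
        rw [hr, hker D.1 D.2] at h2
        rw [mem_cornerSpace ((hτ a).map ι) ((hσ a).map ι)]
        exact ⟨by simpa using h1.symm, by simpa using h2.symm⟩⟩
      map_add' := fun _ _ => rfl
      map_smul' := fun _ _ => rfl }
  have hev : Function.Bijective ev := by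
    constructor
    · intro D D' h
      refine Subtype.ext (Subtype.ext (sub_eq_zero.1 (derivation_eq_zero hadj
        (Submodule.sub_mem _ D.1.2 D'.1.2) (fun b => ?_) fun a => ?_)))
      · rw [LinearMap.sub_apply, hker D.1 D.2, hker D'.1 D'.2, sub_zero]
      · rw [LinearMap.sub_apply, sub_eq_zero]
        exact congrArg Subtype.val (congrFun h a)
    · intro y
      obtain ⟨D, hD, h, h'⟩ := exists_derivation hσ hτ hl hr hadj hlift
        (d := 0) (Submodule.zero_mem _) (fun a => y a)
      refine ⟨⟨⟨D, hD⟩, LinearMap.mem_ker.2 (Subtype.ext (LinearMap.ext h))⟩, ?_⟩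
      ext a
      have hy := (mem_cornerSpace ((hτ a).map ι) ((hσ a).map ι)).1 (y a).2
      change D (arr a) = y a
      rw [h', hy.1, hy.2]
      simp
  rw [← Module.finrank_pi_fintype]
  exact finrank_eq_of_surjective_of_ker res hres ev hev

end Restriction

/-! ### Dimensions computed in the model -/

section ModelDimension

variable {k : Type*} [Field k] {B T : Type*} [Ring B] [Algebra k B] [Ring T] [Algebra k T]
  [FiniteDimensional k B]
  {F : Type*} {σ τ : F → B} {ι : B →ₐ[k] T} {arr : F → T} [Fintype (Word k σ τ)]

instance (e : B) : FiniteDimensional k (leftIdeal e) :=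
  FiniteDimensional.finiteDimensional_submodule ((leftIdeal e).restrictScalars k)

instance (e : B) : FiniteDimensional k (rightIdeal e) :=
  FiniteDimensional.finiteDimensional_submodule ((rightIdeal e).restrictScalars k)

/-- A linear map that factors as a surjection followed by an injection has the rank of the space in
the middle. -/
theorem finrank_range_of_factor {X Y Z : Type*} [AddCommGroup X] [Module k X] [AddCommGroup Y]
    [Module k Y] [AddCommGroup Z] [Module k Z] (i : Z →ₗ[k] Y) (p : X →ₗ[k] Z)
    (hi : Function.Injective i) (hp : Function.Surjective p) :
    Module.finrank k (LinearMap.range (i ∘ₗ p)) = Module.finrank k Z := by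
  rw [LinearMap.range_comp, LinearMap.range_eq_top.2 hp, Submodule.map_top,
    LinearMap.finrank_range_of_inj hi]

/-- The rank of `f ⊕ ⨁_w g_w ⊗ h_w`. -/
theorem finrank_range_prod_pi_tensor {X : Type*} [AddCommGroup X] [Module k X]
    [FiniteDimensional k X] {W : Type*} [Fintype W] {P R : W → Type*}
    [∀ w, AddCommGroup (P w)] [∀ w, Module k (P w)] [∀ w, AddCommGroup (R w)]
    [∀ w, Module k (R w)] [∀ w, FiniteDimensional k (P w)] [∀ w, FiniteDimensional k (R w)]
    (f : X →ₗ[k] X) (g : ∀ w, P w →ₗ[k] P w) (h : ∀ w, R w →ₗ[k] R w)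
    (φ : (X × ∀ w, P w ⊗[k] R w) →ₗ[k] (X × ∀ w, P w ⊗[k] R w))
    (hφ : ∀ m, φ m = (f m.1, fun w => TensorProduct.map (g w) (h w) (m.2 w))) :
    Module.finrank k (LinearMap.range φ) = Module.finrank k (LinearMap.range f) +
      ∑ w, Module.finrank k (LinearMap.range (g w)) *
        Module.finrank k (LinearMap.range (h w)) := by
  -- factor `φ` through its image
  let p : (X × ∀ w, P w ⊗[k] R w) →ₗ[k] LinearMap.range f ×
      ∀ w, LinearMap.range (g w) ⊗[k] LinearMap.range (h w) :=
    LinearMap.prodMap f.rangeRestrict (LinearMap.pi fun w =>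
      TensorProduct.map (g w).rangeRestrict (h w).rangeRestrict ∘ₗ LinearMap.proj w)
  let i : (LinearMap.range f × ∀ w, LinearMap.range (g w) ⊗[k] LinearMap.range (h w)) →ₗ[k]
      (X × ∀ w, P w ⊗[k] R w) :=
    LinearMap.prodMap (LinearMap.range f).subtype (LinearMap.pi fun w =>
      TensorProduct.map (LinearMap.range (g w)).subtype (LinearMap.range (h w)).subtype ∘ₗ
        LinearMap.proj w)
  have hi : Function.Injective i := by
    rintro ⟨u₀, u⟩ ⟨v₀, v⟩ h
    refine Prod.ext (Subtype.ext (congrArg Prod.fst h)) (funext fun w => ?_)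
    exact TensorProduct.map_injective_of_flat_flat _ _ Subtype.val_injective
      Subtype.val_injective (congrFun (congrArg Prod.snd h) w)
  have hp : Function.Surjective p := by
    rintro ⟨u₀, u⟩
    obtain ⟨v₀, hv₀⟩ := f.surjective_rangeRestrict u₀
    choose v hv using fun w => TensorProduct.map_surjective
      (g w).surjective_rangeRestrict (h w).surjective_rangeRestrict (u w)
    exact ⟨(v₀, v), Prod.ext hv₀ (funext hv)⟩
  have hip : φ = i ∘ₗ p := by
    refine LinearMap.ext fun m => (hφ m).trans (Prod.ext rfl (funext fun w => ?_))
    change _ = TensorProduct.map _ _ (TensorProduct.map _ _ (m.2 w))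
    rw [← LinearMap.comp_apply, ← TensorProduct.map_comp]
    rfl
  rw [hip, finrank_range_of_factor i p hi hp, Module.finrank_prod, Module.finrank_pi_fintype]
  simp only [Module.finrank_tensorProduct]

omit [FiniteDimensional k B] in
theorem finrank_range_smul_leftIdeal (y x : B) (hx : IsIdempotentElem x) :
    Module.finrank k (LinearMap.range (Algebra.lsmul k k (leftIdeal x) y)) =
      Module.finrank k (cornerSpace k y x) := by
  have hinj : Function.Injective (((leftIdeal x).restrictScalars k).subtype ∘ₗ
      (LinearMap.range (Algebra.lsmul k k (leftIdeal x) y)).subtype) :=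
    Subtype.val_injective.comp Subtype.val_injective
  rw [← LinearMap.finrank_range_of_inj hinj]
  suffices h : LinearMap.range (((leftIdeal x).restrictScalars k).subtype ∘ₗ
      (LinearMap.range (Algebra.lsmul k k (leftIdeal x) y)).subtype) = cornerSpace k y x by
    rw [h]
  ext z
  constructor
  · rintro ⟨⟨_, b, rfl⟩, rfl⟩
    exact ⟨b, (mul_assoc y (b : B) x).trans (congrArg (y * ·) (mem_leftIdeal.1 b.2))⟩
  · rintro ⟨b, rfl⟩
    refine ⟨⟨_, ⟨⟨b * x, ?_⟩, rfl⟩⟩, ?_⟩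
    · rw [mem_leftIdeal, mul_assoc, hx.eq]
    · exact (mul_assoc y b x).symm

omit [FiniteDimensional k B] in
theorem finrank_range_smul_rightIdeal (y x : B) (hy : IsIdempotentElem y) :
    Module.finrank k (LinearMap.range (Algebra.lsmul k k (rightIdeal y) (MulOpposite.op x))) =
      Module.finrank k (cornerSpace k y x) := by
  have hinj : Function.Injective (((rightIdeal y).restrictScalars k).subtype ∘ₗ
      (LinearMap.range (Algebra.lsmul k k (rightIdeal y) (MulOpposite.op x))).subtype) :=
    Subtype.val_injective.comp Subtype.val_injective
  rw [← LinearMap.finrank_range_of_inj hinj]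
  suffices h : LinearMap.range (((rightIdeal y).restrictScalars k).subtype ∘ₗ
      (LinearMap.range (Algebra.lsmul k k (rightIdeal y) (MulOpposite.op x))).subtype) =
      cornerSpace k y x by
    rw [h]
  ext z
  constructor
  · rintro ⟨⟨_, b, rfl⟩, rfl⟩
    exact ⟨b, congrArg (· * x) (mem_rightIdeal.1 b.2)⟩
  · rintro ⟨b, rfl⟩
    refine ⟨⟨_, ⟨⟨y * b, ?_⟩, rfl⟩⟩, ?_⟩
    · rw [mem_rightIdeal, ← mul_assoc, hy.eq]
    · rfl

variable (hψ : Function.Bijective (modelMap (σ := σ) (τ := τ) ι arr))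
include hψ

theorem finrank_of_modelMap_bijective : Module.finrank k T = Module.finrank k B +
    ∑ w : Word k σ τ, Module.finrank k (leftIdeal (τ w.tgt)) *
      Module.finrank k (rightIdeal (σ w.src)) := by
  rw [← (LinearEquiv.ofBijective _ hψ).finrank_eq, Module.finrank_prod, Module.finrank_pi_fintype]
  simp only [Module.finrank_tensorProduct]

theorem finiteDimensional_of_modelMap_bijective : FiniteDimensional k T :=
  Module.Finite.equiv (LinearEquiv.ofBijective _ hψ)

theorem finrank_derivations_of_modelMap_bijective :
    Module.finrank k (derivations (leftRegular k T ∘ₗ ι.toLinearMap)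
        (rightRegular k T ∘ₗ ι.toLinearMap)) =
      Module.finrank k (derivations (leftRegular k B) (rightRegular k B)) +
      ∑ w : Word k σ τ, Module.finrank k (derivations
        (tensorLeft k (τ w.tgt) (σ w.src)) (tensorRight k (τ w.tgt) (σ w.src))) := by
  let L : B →ₗ[k] Module.End k (∀ w : Word k σ τ, w.Bimod k σ τ) :=
    (Algebra.lsmul k k (∀ w : Word k σ τ, w.Bimod k σ τ)).toLinearMap
  let R : B →ₗ[k] Module.End k (∀ w : Word k σ τ, w.Bimod k σ τ) :=
    { toFun := fun b => LinearMap.pi fun w => tensorRight k _ _ b ∘ₗ LinearMap.proj w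
      map_add' := fun b c => by ext; simp
      map_smul' := fun c b => by ext; simp }
  rw [← finrank_derivations_pi (L := L) (R := R) (fun _ _ _ => rfl) (fun _ _ _ => rfl),
    ← finrank_derivations_prod
      (L := (Algebra.lsmul k k (TensorModel k σ τ)).toLinearMap) (R := TensorModel.right k σ τ)
      (fun _ _ => rfl) (fun _ _ => rfl)]
  exact (finrank_derivations_congr (LinearEquiv.ofBijective _ hψ)
    (fun b m => modelMap_smul b m) (fun b m => modelMap_right b m)).symm

theorem finrank_cornerSpace_of_modelMap_bijective (hσ : ∀ a, IsIdempotentElem (σ a))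
    (hτ : ∀ a, IsIdempotentElem (τ a)) (y x : B) :
    Module.finrank k (cornerSpace k (ι y) (ι x)) = Module.finrank k (cornerSpace k y x) +
    ∑ w : Word k σ τ, Module.finrank k (cornerSpace k y (τ w.tgt)) *
      Module.finrank k (cornerSpace k (σ w.src) x) := by
  let φ : TensorModel k σ τ →ₗ[k] TensorModel k σ τ :=
    Algebra.lsmul k k (TensorModel k σ τ) y ∘ₗ TensorModel.right k σ τ x
  have hφ := finrank_range_prod_pi_tensor (LinearMap.mulLeftRight k (y, x))
    (fun w : Word k σ τ => Algebra.lsmul k k (leftIdeal (τ w.tgt)) y)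
    (fun w : Word k σ τ => Algebra.lsmul k k (rightIdeal (σ w.src)) (MulOpposite.op x)) φ
    (fun m => by
      refine Prod.ext (mul_assoc y m.1 x).symm (funext fun w => ?_)
      change y • tensorRight k _ _ x (m.2 w) = TensorProduct.map _ _ (m.2 w)
      induction m.2 w using TensorProduct.induction_on with
      | zero => simp
      | add u v hu hv => simp only [map_add, smul_add, hu, hv]
      | tmul u v => rfl)
  have hΨ : (cornerSpace k (ι y) (ι x)) = (LinearMap.range φ).map (modelMap ι arr) := by
    ext z
    constructor
    · rintro ⟨z, rfl⟩
      obtain ⟨m, rfl⟩ := hψ.2 z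
      refine ⟨φ m, ⟨m, rfl⟩, ?_⟩
      simp [φ, modelMap_smul, modelMap_right, mul_assoc]
    · rintro ⟨_, ⟨m, rfl⟩, rfl⟩
      exact ⟨modelMap ι arr m, by simp [φ, modelMap_smul, modelMap_right, mul_assoc]⟩
  rw [hΨ, ← (Submodule.equivMapOfInjective _ hψ.1 _).finrank_eq]
  refine hφ.trans ?_
  congr 1
  refine Finset.sum_congr rfl fun w _ => ?_
  exact congrArg₂ (· * ·) (finrank_range_smul_leftIdeal y _ (hτ _))
    (finrank_range_smul_rightIdeal _ x (hσ _))

end ModelDimension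

/-! ### Counting words -/

section Counting

variable {F : Type*} {d : F → F → ℕ}

/-- The number of indices in a word, which is one less than the number of its arrows. -/
def WordPath.length {a : F} : ∀ {b : F}, WordPath d a b → ℕ
  | _, .nil => 0
  | _, .cons p _ => p.length + 1

variable (d) in
/-- The words with `m + 1` arrows. -/
abbrev WordsOfLength (m : ℕ) : Type _ := {w : WordOf d // w.path.length = m}

variable (d) in
/-- The words with one arrow. -/
def wordsZeroEquiv : F ≃ WordsOfLength d 0 where
  toFun a := ⟨⟨a, a, .nil⟩, rfl⟩
  invFun w := w.1.src
  left_inv _ := rfl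
  right_inv := by
    rintro ⟨⟨a, b, p⟩, h⟩
    cases p with
    | nil => rfl
    | cons p i => simp [WordPath.length] at h

variable (d) in
/-- A word with `m + 2` arrows is a word with `m + 1` arrows together with a last arrow and an
index. -/
def wordsSuccEquiv (m : ℕ) :
    (Σ w : WordsOfLength d m, Σ c : F, Fin (d c w.1.tgt)) ≃ WordsOfLength d (m + 1) where
  toFun w := ⟨⟨w.1.1.src, w.2.1, .cons w.1.1.path w.2.2⟩, congrArg (· + 1) w.1.2⟩
  invFun
    | ⟨⟨_, _, .nil⟩, h⟩ => absurd h (by simp [WordPath.length])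
    | ⟨⟨a, c, .cons (b := b) p i⟩, h⟩ => ⟨⟨⟨a, b, p⟩, Nat.succ_injective h⟩, c, i⟩
  left_inv := by
    rintro ⟨⟨⟨a, b, p⟩, h⟩, c, i⟩
    rfl
  right_inv := by
    rintro ⟨⟨a, b, p⟩, h⟩
    cases p with
    | nil => simp [WordPath.length] at h
    | cons p i => rfl

variable [Fintype F]

noncomputable instance WordsOfLength.fintype : ∀ m, Fintype (WordsOfLength d m)
  | 0 => Fintype.ofEquiv _ (wordsZeroEquiv d)
  | m + 1 =>
    letI := WordsOfLength.fintype m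
    Fintype.ofEquiv _ (wordsSuccEquiv d m)

/-- A sum over the words of a given length is a sum over the underlying sequences of arrows, with
the number of choices of indices as weights. -/
theorem sum_wordsOfLength (m : ℕ) (h : F → F → ℤ) :
    ∑ w : WordsOfLength d m, h w.1.src w.1.tgt =
      ∑ g : Fin (m + 1) → F, (∏ i : Fin m, (d (g i.succ) (g i.castSucc) : ℤ)) *
        h (g 0) (g (Fin.last m)) := by
  induction m generalizing h with
  | zero =>
    rw [← (wordsZeroEquiv d).sum_comp, ← (Equiv.funUnique (Fin 1) F).symm.sum_comp]
    simp [wordsZeroEquiv]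
  | succ m ih =>
    rw [← (wordsSuccEquiv d m).sum_comp, Fintype.sum_sigma]
    have h1 : ∀ w : WordsOfLength d m, ∑ y : (Σ c : F, Fin (d c w.1.tgt)),
        h (wordsSuccEquiv d m ⟨w, y⟩).1.src (wordsSuccEquiv d m ⟨w, y⟩).1.tgt =
        ∑ c : F, (d c w.1.tgt : ℤ) * h w.1.src c := by
      intro w
      rw [Fintype.sum_sigma]
      simp [wordsSuccEquiv]
    refine (Finset.sum_congr rfl fun w _ => h1 w).trans
      ((ih fun a b => ∑ c : F, (d c b : ℤ) * h a c).trans ?_)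
    rw [← (Fin.snocEquiv fun _ : Fin (m + 2) => F).sum_comp, Fintype.sum_prod_type_right]
    refine Finset.sum_congr rfl fun g _ => ?_
    rw [Finset.mul_sum]
    refine Finset.sum_congr rfl fun c _ => ?_
    have h0 : (Fin.snoc g c : Fin (m + 2) → F) 0 = g 0 := Fin.snoc_castSucc (i := 0) ..
    simp only [Fin.snocEquiv_apply, Fin.prod_univ_castSucc, Fin.snoc_last, h0, Fin.succ_last,
      ← Fin.castSucc_succ, Fin.snoc_castSucc]
    ring

/-- Without cycles, a chain does not repeat an element of `F`. -/
theorem lt_card_of_chain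
    (hno : ∀ (m : ℕ) (g : Fin (m + 1) → F), (∀ i : Fin m, d (g i.succ) (g i.castSucc) ≠ 0) →
      d (g 0) (g (Fin.last m)) = 0)
    {m : ℕ} (g : Fin (m + 1) → F) (hg : ∀ i : Fin m, d (g i.succ) (g i.castSucc) ≠ 0) :
    m < Fintype.card F := by
  have hinj : Function.Injective g := by
    refine Function.Injective.of_lt_imp_ne fun i j hij heq => ?_
    obtain ⟨i, hi⟩ := i
    obtain ⟨j, hj⟩ := j
    simp only [Fin.mk_lt_mk] at hij
    obtain ⟨n, rfl⟩ := Nat.exists_eq_add_of_lt hij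
    have := hno n (fun l => g ⟨i + l, by omega⟩) (fun l => hg ⟨i + l, by omega⟩)
    have h2 := hg ⟨i + n, by omega⟩
    simp only [Fin.val_zero, add_zero, Fin.val_last, heq] at this
    exact h2 this
  simpa using Fintype.card_le_of_injective g hinj

variable (hno : ∀ (m : ℕ) (g : Fin (m + 1) → F),
  (∀ i : Fin m, d (g i.succ) (g i.castSucc) ≠ 0) → d (g 0) (g (Fin.last m)) = 0)
include hno

theorem length_lt_card (w : WordOf d) : w.path.length < Fintype.card F := by
  have h := sum_wordsOfLength (d := d) w.path.length (fun _ _ => 1)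
  have hpos : 0 < ∑ _w : WordsOfLength d w.path.length, (1 : ℤ) := by
    rw [Finset.sum_const, Finset.card_univ, nsmul_one, Int.natCast_pos, Fintype.card_pos_iff]
    exact ⟨⟨w, rfl⟩⟩
  rw [h] at hpos
  obtain ⟨g, -, hg⟩ := Finset.exists_ne_zero_of_sum_ne_zero hpos.ne'
  refine lt_card_of_chain hno g fun i hi => hg ?_
  rw [Finset.prod_eq_zero (Finset.mem_univ i) (by exact_mod_cast hi), zero_mul]

/-- The words, sorted by their lengths. -/
def wordsSigmaEquiv : (Σ m : Fin (Fintype.card F), WordsOfLength d m) ≃ WordOf d where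
  toFun w := w.2.1
  invFun w := ⟨⟨w.path.length, length_lt_card hno w⟩, w, rfl⟩
  left_inv := by
    rintro ⟨⟨m, hm⟩, w, h⟩
    change w.path.length = m at h
    subst h
    rfl
  right_inv _ := rfl

theorem finite_wordOf : Finite (WordOf d) := Finite.of_equiv _ (wordsSigmaEquiv hno)

theorem sum_wordOf [Fintype (WordOf d)] (h : F → F → ℤ) :
    ∑ w : WordOf d, h w.src w.tgt = ∑ m : Fin (Fintype.card F), ∑ g : Fin (m + 1) → F,
      (∏ i : Fin m, (d (g i.succ) (g i.castSucc) : ℤ)) * h (g 0) (g (Fin.last m)) := by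
  rw [← (wordsSigmaEquiv hno).sum_comp, Fintype.sum_sigma]
  exact Finset.sum_congr rfl fun m _ => sum_wordsOfLength m h

end Counting

/-! ### Counting relative paths -/

section RelPathCounting

variable {k : Type w} {V : Type u} [Quiver.{v} V] [Field k] [Fintype V]
  {F : Type v} [Fintype F] {s t : F → V} {I : TwoSidedIdeal (PathAlgebra k V)}
  [FiniteDimensional k (BoundQuiverAlgebra I)]

theorem finrank_corner_ne_zero {y x : V} :
    Module.finrank k (corner I y x) ≠ 0 ↔ corner I y x ≠ ⊥ := by
  rw [Ne, Submodule.finrank_eq_zero]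

omit [Fintype F] in
theorem RelPath.chain_imp_eq_zero (hF : ∀ γ : RelPath s t I, ¬ γ.IsCycle) (m : ℕ)
    (g : Fin (m + 1) → F)
    (hg : ∀ i : Fin m, Module.finrank k (corner I (s (g i.succ)) (t (g i.castSucc))) ≠ 0) :
    Module.finrank k (corner I (s (g 0)) (t (g (Fin.last m)))) = 0 := by
  by_contra h
  exact hF ⟨m, g, fun i => finrank_corner_ne_zero.1 (hg i)⟩ (finrank_corner_ne_zero.1 h)

/-- The relative paths, sorted by their lengths. -/
def RelPath.sigmaEquiv (hF : ∀ γ : RelPath s t I, ¬ γ.IsCycle) :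
    (Σ m : Fin (Fintype.card F), {g : Fin (m + 1) → F //
      ∀ i : Fin m, corner I (s (g i.succ)) (t (g i.castSucc)) ≠ ⊥}) ≃ RelPath s t I where
  toFun γ := ⟨γ.1, γ.2.1, γ.2.2⟩
  invFun γ := ⟨⟨γ.m, lt_card_of_chain
    (d := fun a b => Module.finrank k (corner I (s a) (t b)))
    (RelPath.chain_imp_eq_zero hF) γ.arrow
    (fun i => finrank_corner_ne_zero.2 (γ.chain i))⟩, γ.arrow, γ.chain⟩
  left_inv _ := rfl
  right_inv _ := rfl

theorem RelPath.finite (hF : ∀ γ : RelPath s t I, ¬ γ.IsCycle) : Finite (RelPath s t I) :=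
  Finite.of_equiv _ (RelPath.sigmaEquiv hF)

/-- A word is a relative path together with a choice of basis elements, of which there are
`dim γ`. -/
theorem sum_word_eq_sum_relPath (hF : ∀ γ : RelPath s t I, ¬ γ.IsCycle)
    [Fintype (WordOf fun a b => Module.finrank k (corner I (s a) (t b)))] [Fintype (RelPath s t I)]
    (h : V → V → ℤ) :
    ∑ w : WordOf fun a b => Module.finrank k (corner I (s a) (t b)), h (s w.src) (t w.tgt) =
      ∑ γ : RelPath s t I, (γ.dim : ℤ) * h γ.src γ.tgt := by
  classical
  rw [sum_wordOf (RelPath.chain_imp_eq_zero hF) (fun a b => h (s a) (t b)),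
    ← (RelPath.sigmaEquiv hF).sum_comp, Fintype.sum_sigma]
  refine Finset.sum_congr rfl fun m _ => ?_
  rw [← Finset.sum_subset (Finset.subset_univ (Finset.univ.filter fun g : Fin (m + 1) → F =>
    ∀ i : Fin m, corner I (s (g i.succ)) (t (g i.castSucc)) ≠ ⊥)),
    ← Finset.sum_subtype_eq_sum_filter]
  · simp only [Finset.subtype_univ]
    refine Finset.sum_congr rfl fun g _ => ?_
    rw [RelPath.dim, Nat.cast_prod]
    rfl
  · intro g _ hg
    simp only [Finset.mem_filter, Finset.mem_univ, true_and, not_forall, not_not] at hg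
    obtain ⟨i, hi⟩ := hg
    rw [Finset.prod_eq_zero (Finset.mem_univ i), zero_mul]
    rw [hi, finrank_bot, Nat.cast_zero]

end RelPathCounting

/-! ### Derivations with values in a space of linear maps -/

section HomBimodule

variable (k : Type*) [Field k] (A : Type*) [Ring A] [Algebra k A]
  (M : Type*) [AddCommGroup M] [Module k M] [Module A M] [IsScalarTower k A M]
  (N : Type*) [AddCommGroup N] [Module k N] [Module A N] [IsScalarTower k A N]

/-- The left action of `A` on `Hom_k(M, N)`. -/
noncomputable def homLeft : A →ₗ[k] Module.End k (M →ₗ[k] N) where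
  toFun a := LinearMap.llcomp k M N N (Algebra.lsmul k k N a)
  map_add' a b := by ext; simp
  map_smul' c a := by ext; simp

/-- The right action of `A` on `Hom_k(M, N)`. -/
noncomputable def homRight : A →ₗ[k] Module.End k (M →ₗ[k] N) where
  toFun a := LinearMap.lcomp k N (Algebra.lsmul k k M a)
  map_add' a b := by ext; simp
  map_smul' c a := by ext; simp

variable {k A M N}

omit [Module A M] [IsScalarTower k A M] in
theorem homLeft_apply (a : A) (f : M →ₗ[k] N) (m : M) : homLeft k A M N a f m = a • f m := rfl

omit [Module A N] [IsScalarTower k A N] in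
theorem homRight_apply (a : A) (f : M →ₗ[k] N) (m : M) : homRight k A M N a f m = f (a • m) := rfl

/-- The `A`-linear map `A ⊗ M → N`, `a ⊗ m ↦ a f(m)`. -/
noncomputable def tensorLift (f : M →ₗ[k] N) : A ⊗[k] M →ₗ[A] N :=
  TensorProduct.AlgebraTensorModule.lift (LinearMap.toSpanSingleton A (M →ₗ[k] N) f)

omit [Module A M] [IsScalarTower k A M] in
theorem tensorLift_tmul (f : M →ₗ[k] N) (a : A) (m : M) :
    tensorLift f (a ⊗ₜ[k] m) = a • f m := rfl

omit [Module A M] [IsScalarTower k A M] in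
theorem eq_tensorLift (g : A ⊗[k] M →ₗ[A] N) :
    g = tensorLift (g.restrictScalars k ∘ₗ TensorProduct.mk k A M 1) := by
  ext m
  simp [tensorLift_tmul]

variable (k A M) in
/-- The multiplication `A ⊗ M → M`. -/
noncomputable abbrev actionMap : A ⊗[k] M →ₗ[A] M := tensorLift (LinearMap.id (R := k))

variable (k A M) in
/-- The retraction `a ⊗ m ↦ a ⊗ m - 1 ⊗ a m` of `A ⊗ M` on the kernel of the multiplication. -/
noncomputable def kerRetraction : A ⊗[k] M →ₗ[k] LinearMap.ker (actionMap k A M) where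
  toFun z := ⟨z - 1 ⊗ₜ[k] actionMap k A M z, by simp [tensorLift_tmul]⟩
  map_add' y z := by ext; simp [TensorProduct.tmul_add]; abel
  map_smul' c z := by ext; simp [smul_sub]

theorem kerRetraction_coe (z : LinearMap.ker (actionMap k A M)) :
    kerRetraction k A M (z : A ⊗[k] M) = z := by
  have := LinearMap.mem_ker.1 z.2
  ext
  simp [kerRetraction, this]

theorem kerRetraction_tmul (a : A) (m : M) :
    (kerRetraction k A M (a ⊗ₜ[k] m) : A ⊗[k] M) = a ⊗ₜ[k] m - 1 ⊗ₜ[k] (a • m) := rfl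

theorem lift_smul_of_mem_derivations {d : A →ₗ[k] M →ₗ[k] N}
    (hd : d ∈ derivations (homLeft k A M N) (homRight k A M N)) (a : A) (z : A ⊗[k] M) :
    TensorProduct.lift d (a • z) = a • TensorProduct.lift d z + d a (actionMap k A M z) := by
  induction z using TensorProduct.induction_on with
  | zero => simp
  | add y z hy hz => simp only [smul_add, map_add, hy, hz]; abel
  | tmul b m =>
    rw [TensorProduct.smul_tmul', TensorProduct.lift.tmul, TensorProduct.lift.tmul, smul_eq_mul,
      hd a b]
    rfl

/-- A derivation `d : A → Hom_k(M, N)` is the same as an `A`-linear map from the kernel of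
`A ⊗ M → M` to `N`, namely the one with `a ⊗ m - 1 ⊗ a m ↦ d(a)(m)`. -/
noncomputable def derivationsEquivKerHom :
    derivations (homLeft k A M N) (homRight k A M N) ≃ₗ[k]
      (LinearMap.ker (actionMap k A M) →ₗ[A] N) where
  toFun d :=
    { toFun := fun z => TensorProduct.lift d.1 z.1
      map_add' := fun y z => by simp
      map_smul' := fun a z => by
        have := LinearMap.mem_ker.1 z.2
        simp [lift_smul_of_mem_derivations d.2, this] }
  map_add' d d' := by
    ext z
    change TensorProduct.lift (d.1 + d'.1) z.1 =
      TensorProduct.lift d.1 z.1 + TensorProduct.lift d'.1 z.1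
    induction z.1 using TensorProduct.induction_on with
    | zero => simp
    | add y z hy hz => simp only [map_add, hy, hz]; abel
    | tmul a m => rfl
  map_smul' c d := by
    ext z
    change TensorProduct.lift (c • d.1) z.1 = c • TensorProduct.lift d.1 z.1
    induction z.1 using TensorProduct.induction_on with
    | zero => simp
    | add y z hy hz => simp only [map_add, smul_add, hy, hz]
    | tmul a m => rfl
  invFun φ := ⟨TensorProduct.curry (φ.restrictScalars k ∘ₗ kerRetraction k A M), fun a b => by
    ext m
    rw [LinearMap.add_apply, homLeft_apply, homRight_apply, TensorProduct.curry_apply,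
      TensorProduct.curry_apply, TensorProduct.curry_apply]
    simp only [LinearMap.comp_apply, LinearMap.restrictScalars_apply]
    rw [← map_smul, ← map_add]
    congr 1
    ext
    simp [kerRetraction_tmul, smul_sub, TensorProduct.smul_tmul', mul_smul]⟩
  left_inv d := by
    ext a m
    have h1 : d.1 1 = 0 := by simpa [LinearMap.ext_iff, homLeft_apply, homRight_apply] using d.2 1 1
    change TensorProduct.lift d.1 (a ⊗ₜ[k] m - 1 ⊗ₜ[k] (a • m)) = d.1 a m
    rw [map_sub, TensorProduct.lift.tmul, TensorProduct.lift.tmul, h1, LinearMap.zero_apply,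
      sub_zero]
  right_inv φ := by
    ext z
    have h : TensorProduct.lift (TensorProduct.curry
        (φ.restrictScalars k ∘ₗ kerRetraction k A M)) =
        φ.restrictScalars k ∘ₗ kerRetraction k A M := TensorProduct.ext' fun _ _ => rfl
    refine (LinearMap.congr_fun h z.1).trans ?_
    rw [LinearMap.comp_apply, kerRetraction_coe]
    rfl

variable (k A M N) in
/-- The inner derivation `a ↦ a f - f a` attached to `f ∈ Hom_k(M, N)`. -/
noncomputable def innerDerivation : (M →ₗ[k] N) →ₗ[k] A →ₗ[k] M →ₗ[k] N :=
  (homLeft k A M N - homRight k A M N).flip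

theorem innerDerivation_mem (f : M →ₗ[k] N) :
    innerDerivation k A M N f ∈ derivations (homLeft k A M N) (homRight k A M N) := by
  intro a b
  ext m
  simp [innerDerivation, homLeft_apply, homRight_apply, mul_smul]

theorem innerDerivation_eq_zero_iff (f : M →ₗ[k] N) :
    innerDerivation k A M N f = 0 ↔ ∃ g : M →ₗ[A] N, g.restrictScalars k = f := by
  constructor
  · intro h
    refine ⟨{ f with map_smul' := fun a m => ?_ }, rfl⟩
    have := LinearMap.congr_fun (LinearMap.congr_fun h a) m
    exact (sub_eq_zero.1 this).symm
  · rintro ⟨g, rfl⟩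
    ext a m
    simp [innerDerivation, homLeft_apply, homRight_apply]

theorem derivationsEquivKerHom_inner (f : M →ₗ[k] N) :
    derivationsEquivKerHom ⟨innerDerivation k A M N f, innerDerivation_mem f⟩ =
      tensorLift f ∘ₗ (LinearMap.ker (actionMap k A M)).subtype := by
  ext z
  have key : ∀ z : A ⊗[k] M, TensorProduct.lift (innerDerivation k A M N f) z =
      tensorLift f z - f (actionMap k A M z) := by
    intro z
    induction z using TensorProduct.induction_on with
    | zero => simp
    | add y z hy hz => simp only [map_add, hy, hz]; abel
    | tmul a m => rfl
  refine (key z).trans ?_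
  rw [LinearMap.mem_ker.1 z.2, map_zero, sub_zero]
  rfl

end HomBimodule

/-! ### Dimensions of `Hom` and `Ext¹` -/

section Ext

variable {k : Type*} [Field k]

/-- Exactness of `0 → Z → X → K → E → 0` and dimension count. -/
theorem finrank_four_term {X Y E Z : Type*} [AddCommGroup X] [Module k X] [AddCommGroup Y]
    [Module k Y] [AddCommGroup E] [Module k E] [AddCommGroup Z] [Module k Z]
    [FiniteDimensional k X] [FiniteDimensional k Y] (K : Submodule k Y) (j : Z →ₗ[k] X)
    (hj : Function.Injective j) (α : X →ₗ[k] Y) (hjα : ∀ x, α x = 0 ↔ ∃ z, j z = x)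
    (hα : ∀ x, α x ∈ K) (δ : K →ₗ[k] E) (hδ : Function.Surjective δ)
    (hαδ : ∀ y, δ y = 0 ↔ ∃ x, α x = y) :
    Module.Finite k Z ∧ Module.Finite k E ∧
      (Module.finrank k E : ℤ) - Module.finrank k Z = Module.finrank k K - Module.finrank k X := by
  refine ⟨Module.Finite.of_injective j hj, Module.Finite.of_surjective δ hδ, ?_⟩
  have h1 := LinearMap.finrank_range_add_finrank_ker δ
  have h2 := LinearMap.finrank_range_add_finrank_ker α
  have h3 : LinearMap.ker α = LinearMap.range j := by ext x; exact hjα x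
  have h4 : (LinearMap.ker δ).map K.subtype = LinearMap.range α := by
    ext y
    constructor
    · rintro ⟨y, hy, rfl⟩
      exact (hαδ y).1 hy
    · rintro ⟨x, rfl⟩
      exact ⟨⟨α x, hα x⟩, (hαδ _).2 ⟨x, rfl⟩, rfl⟩
  rw [LinearMap.range_eq_top.2 hδ, finrank_top,
    (Submodule.equivMapOfInjective K.subtype Subtype.val_injective _).finrank_eq, h4] at h1
  rw [h3, LinearMap.finrank_range_of_inj hj] at h2
  omega

open Abelian ModuleCat

variable {A : Type u} [Ring A] [Algebra k A] [FiniteDimensional k A]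

/-- The connecting map `Hom_A(K, N) → Ext¹_A(M, N)`, where `K` is the kernel of `A ⊗ M → M`,
composed with the description of `Hom_A(K, N)` by derivations. -/
noncomputable def derivationsToExt (M N : ModuleCat.{u} A)
    (hS : (actionMap k A M).shortComplexKer.ShortExact) :
    derivations (homLeft k A M N) (homRight k A M N) →ₗ[k] Ext M N 1 where
  toFun d := hS.extClass.comp (Ext.mk₀ (ModuleCat.ofHom (derivationsEquivKerHom d))) (add_zero 1)
  map_add' d d' := by
    rw [map_add, ModuleCat.ofHom_add, Ext.mk₀_add, Ext.comp_add]
  map_smul' c d := by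
    rw [RingHom.id_apply, ← Ext.comp_smul, ← Ext.mk₀_smul, map_smul]
    rfl

/-- The spaces `Hom_A(M, N)` and `Ext¹_A(M, N)` are the kernel and the cokernel of the map that
sends an element of `Hom_k(M, N)` to its inner derivation. -/
theorem finrank_ext (M N : ModuleCat.{u} A) [Module.Finite k M] [Module.Finite k N] :
    Module.Finite k (M ⟶ N) ∧ Module.Finite k (Ext M N 1) ∧
      (Module.finrank k (Ext M N 1) : ℤ) - Module.finrank k (M ⟶ N) =
        Module.finrank k (derivations (homLeft k A M N) (homRight k A M N)) -
          Module.finrank k M * Module.finrank k N := by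
  have hsurj : Function.Surjective (actionMap k A M) := fun m =>
    ⟨1 ⊗ₜ[k] m, by simp [tensorLift_tmul]⟩
  have hS := LinearMap.shortExact_shortComplexKer hsurj
  have : Projective (actionMap k A M).shortComplexKer.X₂ :=
    ModuleCat.projective_of_free (Module.Free.chooseBasis A (A ⊗[k] M))
  let j : (M ⟶ N) →ₗ[k] (M →ₗ[k] N) :=
    { toFun := fun g => g.hom.restrictScalars k
      map_add' := fun _ _ => rfl
      map_smul' := fun _ _ => rfl }
  have hj : Function.Injective j := fun g g' h => by
    ext m
    exact LinearMap.congr_fun h m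
  have key := finrank_four_term (derivations (homLeft k A M N) (homRight k A M N)) j hj
    (innerDerivation k A M N)
    (fun f => (innerDerivation_eq_zero_iff f).trans
      ⟨fun ⟨g, hg⟩ => ⟨ModuleCat.ofHom g, hg⟩, fun ⟨g, hg⟩ => ⟨g.hom, hg⟩⟩)
    innerDerivation_mem (derivationsToExt M N hS)
    (fun x => by
      obtain ⟨y, hy⟩ := Ext.contravariant_sequence_exact₃ hS N x (Ext.eq_zero_of_projective _)
        (add_zero 1)
      obtain ⟨φ, rfl⟩ := Ext.addEquiv₀.symm.surjective y
      refine ⟨derivationsEquivKerHom.symm φ.hom, ?_⟩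
      change hS.extClass.comp (Ext.mk₀ (ModuleCat.ofHom (derivationsEquivKerHom
        (derivationsEquivKerHom.symm φ.hom)))) (add_zero 1) = x
      rw [LinearEquiv.apply_symm_apply]
      exact hy)
    (fun d => by
      constructor
      · intro hd
        obtain ⟨y, hy⟩ := Ext.contravariant_sequence_exact₁ hS N _ (add_zero 1) hd
        obtain ⟨ψ, rfl⟩ := Ext.addEquiv₀.symm.surjective y
        have h1 : (actionMap k A M).shortComplexKer.f ≫ ψ =
            ModuleCat.ofHom (derivationsEquivKerHom d) := by
          refine (Ext.mk₀_bijective _ _).1 ?_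
          rw [← Ext.mk₀_comp_mk₀]
          exact hy
        have h2 := eq_tensorLift (k := k) ψ.hom
        set f := ψ.hom.restrictScalars k ∘ₗ TensorProduct.mk k A M 1
        refine ⟨f, congrArg Subtype.val
          (?_ : ⟨innerDerivation k A M N f, innerDerivation_mem f⟩ = d)⟩
        refine derivationsEquivKerHom.injective ?_
        rw [derivationsEquivKerHom_inner, ← h2]
        exact congrArg ModuleCat.Hom.hom h1
      · rintro ⟨f, hf⟩
        have hd : d = ⟨innerDerivation k A M N f, innerDerivation_mem f⟩ := Subtype.ext hf.symm
        have h2 : ModuleCat.ofHom (derivationsEquivKerHom d) =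
            (actionMap k A M).shortComplexKer.f ≫ ModuleCat.ofHom (tensorLift f) := by
          rw [hd, derivationsEquivKerHom_inner]
          rfl
        change hS.extClass.comp (Ext.mk₀ (ModuleCat.ofHom (derivationsEquivKerHom d)))
          (add_zero 1) = 0
        rw [h2, ← Ext.mk₀_comp_mk₀]
        exact hS.extClass_comp_assoc _)
  rw [Module.finrank_linearMap] at key
  exact_mod_cast key

end Ext

/-! ### Projective covers of simple modules -/

/-- A multiplicative filtration `J` of an algebra that vanishes from some point on, such that the
idempotents `e x` span the algebra modulo `J 1`. For a bound quiver algebra, `J l` is spanned by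
the paths of length at least `l`. -/
structure IsBasicFiltration {k : Type*} [Field k] {B : Type*} [Ring B] [Algebra k B] {V : Type*}
    [Fintype V] (e : V → B) (J : ℕ → Submodule k B) : Prop where
  orthogonal : OrthogonalIdempotents e
  zero : J 0 = ⊤
  mul : ∀ {l m : ℕ} {a b : B}, a ∈ J l → b ∈ J m → a * b ∈ J (l + m)
  nilpotent : ∃ n, J n = ⊥
  exists_sub_mem : ∀ b : B, ∃ c : V → k, b - ∑ x, c x • e x ∈ J 1

namespace IsBasicFiltration

variable {k : Type w} [Field k] {B : Type z} [Ring B] [Algebra k B] {V : Type*} [Fintype V]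
  {e : V → B} {J : ℕ → Submodule k B} (hJ : IsBasicFiltration e J)
include hJ

theorem idem (x : V) : IsIdempotentElem (e x) := hJ.orthogonal.idem x

theorem mul_mem_left (b : B) {r : B} {l : ℕ} (hr : r ∈ J l) : b * r ∈ J l := by
  have := hJ.mul (l := 0) (a := b) (by rw [hJ.zero]; trivial) hr
  rwa [zero_add] at this

theorem isNilpotent {r : B} (hr : r ∈ J 1) : IsNilpotent r := by
  obtain ⟨n, hn⟩ := hJ.nilpotent
  refine ⟨n, ?_⟩
  have : ∀ m, r ^ m ∈ J m := by
    intro m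
    induction m with
    | zero => rw [hJ.zero]; trivial
    | succ m ih => rw [pow_succ]; exact hJ.mul ih hr
  simpa [hn] using this n

theorem mul_sum_smul (x : V) (c : V → k) : e x * ∑ z, c z • e z = c x • e x := by
  classical
  rw [Finset.mul_sum, Finset.sum_eq_single x]
  · rw [mul_smul_comm, (hJ.idem x).eq]
  · intro z _ hz
    rw [mul_smul_comm, hJ.orthogonal.ortho hz.symm, smul_zero]
  · simp

/-- The right ideal `xB` is spanned by `x` modulo the radical. -/
theorem exists_rightIdeal_sub_mem {x : V} {b : B} (hb : e x * b = b) :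
    ∃ c : k, b - c • e x ∈ J 1 := by
  obtain ⟨c, hc⟩ := hJ.exists_sub_mem b
  refine ⟨c x, ?_⟩
  have := hJ.mul_mem_left (e x) hc
  rwa [mul_sub, hb, hJ.mul_sum_smul] at this

/-- The radical annihilates simple modules. -/
theorem smul_eq_zero_of_isSimpleModule {S : Type*} [AddCommGroup S] [Module B S]
    [IsSimpleModule B S] {r : B} (hr : r ∈ J 1) (m : S) : r • m = 0 := by
  by_contra hm
  obtain ⟨b, hb⟩ : ∃ b : B, b • (r • m) = m := by
    have hsurj := (LinearMap.surjective_of_ne_zero (f := LinearMap.toSpanSingleton B S (r • m))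
      fun h => hm (by simpa using LinearMap.congr_fun h 1))
    exact hsurj m
  obtain ⟨n, hn⟩ := hJ.isNilpotent (hJ.mul_mem_left b hr)
  have : ∀ l : ℕ, (b * r) ^ l • m = m := by
    intro l
    induction l with
    | zero => simp
    | succ l ih => rw [pow_succ, mul_smul, mul_smul b r, hb, ih]
  have hm0 := this n
  rw [hn, zero_smul] at hm0
  exact hm (by rw [← hm0, smul_zero])

/-- If `e x` does not annihilate the module `S`, then the kernel of a map `B e_x → S`, `b ↦ b m`
with `e_x m = m ≠ 0` is superfluous: in the local ring `e_x B e_x`, an element that annihilates `m`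
is nilpotent. -/
theorem superfluous {S : Type*} [AddCommGroup S] [Module B S] {x : V} {m : S} (hm : e x • m = m)
    (hm0 : m ≠ 0) (N : Submodule B (leftIdeal (e x)))
    (hN : N ⊔ LinearMap.ker (LinearMap.toSpanSingleton B S m ∘ₗ (leftIdeal (e x)).subtype) = ⊤) :
    N = ⊤ := by
  have hidem := hJ.idem x
  obtain ⟨y, hy, z, hz, hyz⟩ := Submodule.mem_sup.1
    (hN ▸ Submodule.mem_top : leftIdeal.gen hidem ∈ N ⊔ _)
  have hyz' : (y : B) + z = e x := congrArg Subtype.val hyz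
  have hzm : (z : B) • m = 0 := hz
  have hzx : (z : B) * e x = z := z.2
  -- `z` is replaced by the element `κ = e_x z` of `e_x B e_x`
  obtain ⟨c, hc⟩ := hJ.exists_rightIdeal_sub_mem (x := x) (b := e x * z)
    (by rw [← mul_assoc, hidem.eq])
  obtain ⟨n, hn⟩ := hJ.isNilpotent hc
  set r : B := e x * z - c • e x with hr
  have hrm : r • m = (algebraMap k B (-c)) • m := by
    rw [hr, sub_smul, mul_smul, hzm, smul_zero, zero_sub, Algebra.smul_def, mul_smul, hm, map_neg,
      neg_smul]
  have hrn : ∀ l : ℕ, r ^ l • m = (algebraMap k B ((-c) ^ l)) • m := by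
    intro l
    induction l with
    | zero => simp
    | succ l ih =>
      rw [pow_succ, mul_smul, hrm, ← mul_smul, ← Algebra.commutes, mul_smul, ih, ← mul_smul,
        ← map_mul, pow_succ']
  have hc0 : c = 0 := by
    by_contra hc0
    have h := hrn n
    rw [hn, zero_smul] at h
    refine hm0 ?_
    have hu : algebraMap k B (((-c) ^ n)⁻¹) * algebraMap k B ((-c) ^ n) = 1 := by
      rw [← map_mul, inv_mul_cancel₀ (pow_ne_zero _ (neg_ne_zero.2 hc0)), map_one]
    rw [← one_smul B m, ← hu, mul_smul, ← h, smul_zero]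
  rw [hc0, zero_smul, sub_zero] at hr
  obtain ⟨u, hu⟩ := (IsNilpotent.isUnit_one_sub (r := r) ⟨n, hn⟩)
  have hgen : leftIdeal.gen hidem = ((↑u⁻¹ : B) * e x) • y := by
    refine Subtype.ext ?_
    change e x = ↑u⁻¹ * e x * (y : B)
    have : e x * (y : B) = (1 - r) * e x := by
      rw [← sub_eq_of_eq_add hyz'.symm, mul_sub, hidem.eq, sub_mul, one_mul, hr, mul_assoc, hzx]
    rw [mul_assoc, this, ← hu, ← mul_assoc, Units.inv_mul, one_mul]
  rw [eq_top_iff]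
  intro b _
  have hb : b = (b : B) • leftIdeal.gen hidem := Subtype.ext b.2.symm
  rw [hb, hgen]
  exact N.smul_mem _ (N.smul_mem _ hy)

omit hJ in
theorem projective_leftIdeal {x : B} (hx : IsIdempotentElem x) :
    Module.Projective B (leftIdeal x) :=
  Module.Projective.of_split (leftIdeal x).subtype
    (LinearMap.toSpanSingleton B (leftIdeal x) (leftIdeal.gen hx))
    (LinearMap.ext fun b => Subtype.ext b.2)

/-- The projective cover of the simple module at `x` is `B e_x`. -/
theorem nonempty_equiv_of_isProjectiveCover {P S : Type*} [AddCommGroup P] [Module B P]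
    [AddCommGroup S] [Module B S] [IsSimpleModule B S] [Module.Projective B P] (π : P →ₗ[B] S)
    (hπ : Function.Surjective π) (hsup : ∀ N : Submodule B P, N ⊔ LinearMap.ker π = ⊤ → N = ⊤)
    {x : V} (hS : ∃ m : S, e x • m ≠ 0) : Nonempty (P ≃ₗ[B] leftIdeal (e x)) := by
  obtain ⟨m, hm⟩ := hS
  have hidem := hJ.idem x
  have hxm : e x • e x • m = e x • m := by rw [← mul_smul, hidem.eq]
  set φ : leftIdeal (e x) →ₗ[B] S :=
    LinearMap.toSpanSingleton B S (e x • m) ∘ₗ (leftIdeal (e x)).subtype with hφ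
  have hφs : Function.Surjective φ := LinearMap.surjective_of_ne_zero fun h => hm <| by
    have := LinearMap.congr_fun h (leftIdeal.gen hidem)
    exact hxm.symm.trans this
  have := projective_leftIdeal hidem
  obtain ⟨g, hg⟩ := Module.projective_lifting_property π φ hπ
  have hgs : Function.Surjective g := by
    rw [← LinearMap.range_eq_top]
    refine hsup _ (eq_top_iff.2 fun p _ => ?_)
    obtain ⟨b, hb⟩ := hφs (π p)
    rw [Submodule.mem_sup]
    refine ⟨g b, ⟨b, rfl⟩, p - g b, ?_, by abel⟩
    rw [LinearMap.mem_ker, map_sub, ← hb, ← hg, LinearMap.comp_apply, sub_self]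
  obtain ⟨σ, hσ⟩ := Module.projective_lifting_property g LinearMap.id hgs
  have hσg : ∀ p, g (σ p) = p := LinearMap.congr_fun hσ
  have hσs : Function.Surjective σ := by
    rw [← LinearMap.range_eq_top]
    refine hJ.superfluous hxm hm _ (eq_top_iff.2 fun b _ => ?_)
    rw [Submodule.mem_sup]
    refine ⟨σ (g b), ⟨_, rfl⟩, b - σ (g b), ?_, by abel⟩
    rw [← hφ, LinearMap.mem_ker, map_sub, ← hg, LinearMap.comp_apply, LinearMap.comp_apply, hσg,
      sub_self]
  exact ⟨LinearEquiv.ofBijective σ ⟨Function.LeftInverse.injective hσg, hσs⟩⟩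

end IsBasicFiltration

/-! ### The duals of the right ideals -/

section DualRight

variable (k : Type w) [Field k] {B : Type z} [Ring B] [Algebra k B]

/-- The left module `Hom_k(eB, k)`. -/
def DualRight (e : B) : Type (max z w) := Module.Dual k (rightIdeal e)

variable {k} {e : B}

noncomputable instance : AddCommGroup (DualRight k e) :=
  inferInstanceAs (AddCommGroup (Module.Dual k (rightIdeal e)))

noncomputable instance : Module k (DualRight k e) :=
  inferInstanceAs (Module k (Module.Dual k (rightIdeal e)))

instance [FiniteDimensional k B] : FiniteDimensional k (DualRight k e) :=
  inferInstanceAs (FiniteDimensional k (Module.Dual k (rightIdeal e)))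

/-- The evaluation of a functional on `eB`. -/
noncomputable def DualRight.eval : DualRight k e ≃ₗ[k] Module.Dual k (rightIdeal e) :=
  LinearEquiv.refl _ _

/-- The action of `B` is given by `(b f)(c) = f(c b)`. -/
noncomputable instance : Module B (DualRight k e) where
  smul b f := DualRight.eval.symm
    (DualRight.eval f ∘ₗ Algebra.lsmul k k (rightIdeal e) (MulOpposite.op b))
  one_smul f := LinearMap.ext fun c => congrArg (DualRight.eval f) (one_smul _ c)
  mul_smul a b f := LinearMap.ext fun c =>
    congrArg (DualRight.eval f) (mul_smul (MulOpposite.op b) (MulOpposite.op a) c)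
  smul_zero b := rfl
  smul_add b f g := rfl
  add_smul a b f := LinearMap.ext fun c => by
    refine (congrArg (DualRight.eval f) (add_smul (MulOpposite.op a) (MulOpposite.op b) c)).trans ?_
    exact map_add _ _ _
  zero_smul f := LinearMap.ext fun c => by
    refine (congrArg (DualRight.eval f) (zero_smul _ c)).trans ?_
    exact map_zero _

theorem DualRight.eval_smul (b : B) (f : DualRight k e) (c : rightIdeal e) :
    DualRight.eval (b • f) c = DualRight.eval f (MulOpposite.op b • c) := rfl

theorem DualRight.ext {f g : DualRight k e}
    (h : ∀ c, DualRight.eval f c = DualRight.eval g c) : f = g := LinearMap.ext h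

instance : IsScalarTower k B (DualRight k e) where
  smul_assoc c b f := DualRight.ext fun d => by
    rw [DualRight.eval_smul, MulOpposite.op_smul, smul_assoc, map_smul]
    rfl

/-- The generator `e` of `eB`. -/
def rightIdeal.gen {e : B} (h : IsIdempotentElem e) : rightIdeal e := ⟨e, h⟩

/-- A linear functional `l` on a module `M` gives the `B`-linear map `M → Hom_k(eB, k)`,
`m ↦ (c ↦ l(c m))`. -/
noncomputable def toDualRight {M : Type*} [AddCommGroup M] [Module k M] [Module B M]
    [IsScalarTower k B M] (e : B) (l : M →ₗ[k] k) : M →ₗ[B] DualRight k e where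
  toFun m := DualRight.eval.symm
    { toFun := fun c => l ((c : B) • m)
      map_add' := fun c d => by simp [add_smul]
      map_smul' := fun c d => by simp }
  map_add' m m' := DualRight.ext fun c => by
    change l ((c : B) • (m + m')) = l ((c : B) • m) + l ((c : B) • m')
    rw [smul_add, map_add]
  map_smul' b m := DualRight.ext fun c => by
    change l ((c : B) • b • m) = l (((c : B) * b) • m)
    rw [mul_smul]

theorem eval_toDualRight {M : Type*} [AddCommGroup M] [Module k M] [Module B M]
    [IsScalarTower k B M] (l : M →ₗ[k] k) (m : M) (c : rightIdeal e) :
    DualRight.eval (toDualRight e l m) c = l ((c : B) • m) := rfl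

/-- The maps `M → Hom_k(eB, k)` correspond to functionals on `eM`, and functionals extend. -/
theorem injective_dualRight (he : IsIdempotentElem e) : Module.Injective B (DualRight k e) where
  out X Y _ _ _ _ f hf g := by
    let : Module k X := Module.restrictScalars k B X
    let : Module k Y := Module.restrictScalars k B Y
    have : IsScalarTower k B X := IsScalarTower.restrictScalars k B X
    have : IsScalarTower k B Y := IsScalarTower.restrictScalars k B Y
    obtain ⟨ρ, hρ⟩ := (f.restrictScalars k).exists_leftInverse_of_injective
      (LinearMap.ker_eq_bot.2 hf)
    have hρ' : ∀ m, ρ (f m) = m := LinearMap.congr_fun hρ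
    let l : X →ₗ[k] k :=
      LinearMap.applyₗ (rightIdeal.gen he) ∘ₗ DualRight.eval.toLinearMap ∘ₗ g.restrictScalars k
    refine ⟨toDualRight e (l ∘ₗ ρ), fun m => DualRight.ext fun c => ?_⟩
    rw [eval_toDualRight, LinearMap.comp_apply, ← map_smul, hρ']
    change DualRight.eval (g ((c : B) • m)) (rightIdeal.gen he) = _
    rw [map_smul, DualRight.eval_smul]
    exact congrArg _ (Subtype.ext c.2)

end DualRight

/-! ### Injective envelopes of simple modules -/

namespace IsBasicFiltration

variable {k : Type w} [Field k] {B : Type z} [Ring B] [Algebra k B] {V : Type*} [Fintype V]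
  {e : V → B} {J : ℕ → Submodule k B} (hJ : IsBasicFiltration e J)
include hJ

/-- The injective envelope of the simple module at `x` is `Hom_k(e_x B, k)`. -/
theorem nonempty_equiv_of_isInjectiveEnvelope {E S : Type (max z w)} [AddCommGroup E] [Module B E]
    [AddCommGroup S] [Module B S] [IsSimpleModule B S] (hinj : Module.Injective B E)
    (ι : S →ₗ[B] E) (hι : Function.Injective ι)
    (hess : ∀ N : Submodule B E, N ⊓ LinearMap.range ι = ⊥ → N = ⊥) {x : V}
    (hS : ∃ m : S, e x • m ≠ 0) : Nonempty (E ≃ₗ[B] DualRight k (e x)) := by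
  obtain ⟨m, hm⟩ := hS
  have hidem := hJ.idem x
  let : Module k S := Module.restrictScalars k B S
  have : IsScalarTower k B S := IsScalarTower.restrictScalars k B S
  obtain ⟨l, hl⟩ : ∃ l : S →ₗ[k] k, l (e x • m) ≠ 0 := by
    by_contra! h
    exact hm ((Module.forall_dual_apply_eq_zero_iff k _).1 h)
  set φ : S →ₗ[B] DualRight k (e x) := toDualRight (e x) l with hφ
  have hφi : Function.Injective φ := LinearMap.injective_of_ne_zero fun h => hl <| by
    have := LinearMap.congr_fun h m
    exact congrArg (fun f => DualRight.eval f (rightIdeal.gen hidem)) this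
  -- the image of `S` is essential: it contains all functionals that vanish on the radical
  have hsoc : ∀ g : DualRight k (e x), (∀ c : rightIdeal (e x), (c : B) ∈ J 1 →
      DualRight.eval g c = 0) → g ∈ LinearMap.range φ := by
    intro g hg
    refine ⟨(DualRight.eval g (rightIdeal.gen hidem) / l (e x • m)) • m, DualRight.ext fun c => ?_⟩
    obtain ⟨a, ha⟩ := hJ.exists_rightIdeal_sub_mem c.2
    have h1 : c = a • rightIdeal.gen hidem + (c - a • rightIdeal.gen hidem) := by abel
    have h2 := hg (c - a • rightIdeal.gen hidem) ha
    rw [hφ, eval_toDualRight]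
    have h3 : (c : B) • m = a • e x • m := by
      have := hJ.smul_eq_zero_of_isSimpleModule ha m
      rw [sub_smul, smul_assoc] at this
      exact sub_eq_zero.1 this
    rw [smul_comm (c : B), h3, l.map_smul _ (a • e x • m), l.map_smul a (e x • m), h1, map_add, h2,
      (DualRight.eval g).map_smul, add_zero,
      smul_eq_mul, smul_eq_mul, smul_eq_mul]
    field_simp
  have hess' : ∀ N : Submodule B (DualRight k (e x)), N ⊓ LinearMap.range φ = ⊥ → N = ⊥ := by
    intro N hN
    by_contra hne
    obtain ⟨f, hf, hf0⟩ := Submodule.exists_mem_ne_zero_of_ne_bot hne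
    obtain ⟨n, hn⟩ := hJ.nilpotent
    have hex : ∃ l, ∀ c : rightIdeal (e x), (c : B) ∈ J l → DualRight.eval f c = 0 := by
      refine ⟨n, fun c hc => ?_⟩
      rw [hn, Submodule.mem_bot] at hc
      rw [show c = 0 from Subtype.ext hc, map_zero]
    classical
    -- a power of the radical on which `f` does not vanish, although it does on the next one
    obtain ⟨i, hi⟩ : ∃ i, Nat.find hex = i + 1 := Nat.exists_eq_succ_of_ne_zero fun h0 => hf0 <| by
      have := Nat.find_spec hex
      rw [h0, hJ.zero] at this
      exact DualRight.ext fun c => this c trivial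
    have h1 := Nat.find_spec hex
    have h2 := Nat.find_min hex (m := i) (by omega)
    rw [hi] at h1
    push Not at h2
    obtain ⟨b, hb, hfb⟩ := h2
    have hmem : (b : B) • f ∈ N ⊓ LinearMap.range φ := by
      refine ⟨N.smul_mem _ hf, hsoc _ fun c hc => ?_⟩
      rw [DualRight.eval_smul]
      refine h1 _ ?_
      have := hJ.mul hc hb
      rwa [add_comm] at this
    rw [hN, Submodule.mem_bot] at hmem
    refine hfb ?_
    have := congrArg (fun g => DualRight.eval g (rightIdeal.gen hidem)) hmem
    rw [← (show MulOpposite.op (b : B) • rightIdeal.gen hidem = b from Subtype.ext b.2)]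
    exact this
  have hinj' := injective_dualRight (k := k) hidem
  obtain ⟨g, hg⟩ := hinj'.out ι hι φ
  have hgi : Function.Injective g := by
    rw [← LinearMap.ker_eq_bot]
    refine hess _ (eq_bot_iff.2 ?_)
    rintro _ ⟨hy, z, rfl⟩
    have : φ z = 0 := (hg z).symm.trans hy
    rw [show z = 0 from hφi (this.trans (map_zero φ).symm), map_zero]
    exact Submodule.zero_mem _
  obtain ⟨h, hh⟩ := hinj.out g hgi LinearMap.id
  have hhi : Function.Injective h := by
    rw [← LinearMap.ker_eq_bot]
    refine hess' _ (eq_bot_iff.2 ?_)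
    rintro _ ⟨hy, z, rfl⟩
    have h0 : h (φ z) = 0 := hy
    have : ι z = 0 := by rw [← h0, ← hg z, hh]; rfl
    rw [show z = 0 from hι (this.trans (map_zero ι).symm), map_zero]
    exact Submodule.zero_mem _
  exact ⟨(LinearEquiv.ofBijective h ⟨hhi, fun y => ⟨g y, hh y⟩⟩).symm⟩

end IsBasicFiltration

/-! ### `Hom` and `Ext¹` between indecomposable injective and projective modules -/

section HomTensor

variable {k : Type w} [Field k] {B : Type z} [Ring B] [Algebra k B] [FiniteDimensional k B]

/-- The bimodules `By ⊗ xB` and `Hom_k(Hom_k(xB, k), By)` are isomorphic. -/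
noncomputable def tensorEquivHom (y x : B) :
    leftIdeal y ⊗[k] rightIdeal x ≃ₗ[k] (DualRight k x →ₗ[k] leftIdeal y) :=
  TensorProduct.comm k (leftIdeal y) (rightIdeal x) ≪≫ₗ
    TensorProduct.congr (Module.evalEquiv k (rightIdeal x)) (LinearEquiv.refl k (leftIdeal y)) ≪≫ₗ
    dualTensorHomEquiv k (Module.Dual k (rightIdeal x)) (leftIdeal y)

open Abelian ModuleCat in
/-- For modules `E ≅ Hom_k(xB, k)` and `P ≅ By`, the dimensions of `Hom` and `Ext¹` are governed by
the derivations of `B` in `By ⊗ xB`. -/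
theorem finrank_ext_of_equiv {y x : B} (E P : ModuleCat.{z} B) (φ : DualRight k x ≃ₗ[B] E)
    (ψ : leftIdeal y ≃ₗ[B] P) :
    Module.Finite k (E ⟶ P) ∧ Module.Finite k (Ext E P 1) ∧
      (Module.finrank k (Ext E P 1) : ℤ) - Module.finrank k (E ⟶ P) =
        Module.finrank k (derivations (tensorLeft k y x) (tensorRight k y x)) -
          Module.finrank k (leftIdeal y) * Module.finrank k (rightIdeal x) := by
  let φ' : DualRight k x ≃ₗ[k] E := φ.restrictScalars k
  let ψ' : leftIdeal y ≃ₗ[k] P := ψ.restrictScalars k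
  have : Module.Finite k E := Module.Finite.equiv φ'
  have : Module.Finite k P := Module.Finite.equiv ψ'
  obtain ⟨h1, h2, h3⟩ := finrank_ext (k := k) E P
  refine ⟨h1, h2, h3.trans ?_⟩
  have h4 : Module.finrank k E = Module.finrank k (rightIdeal x) := by
    rw [← φ'.finrank_eq]
    exact Subspace.dual_finrank_eq
  rw [h4, ← ψ'.finrank_eq, mul_comm]
  congr 2
  refine (finrank_derivations_congr (tensorEquivHom y x ≪≫ₗ LinearEquiv.arrowCongr φ' ψ')
    (fun b u => ?_) (fun b u => ?_)).symm
  · ext m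
    simp only [LinearEquiv.trans_apply, LinearEquiv.arrowCongr_apply, homLeft_apply]
    have : tensorEquivHom y x (tensorLeft k y x b u) (φ'.symm m) =
        b • tensorEquivHom y x u (φ'.symm m) := by
      induction u using TensorProduct.induction_on with
      | zero => simp
      | add u v hu hv => simp only [map_add, LinearMap.add_apply, hu, hv, smul_add]
      | tmul p r => exact smul_comm _ _ _
    rw [this]
    exact map_smul ψ _ _
  · ext m
    simp only [LinearEquiv.trans_apply, LinearEquiv.arrowCongr_apply, homRight_apply]
    have h : φ'.symm (b • m) = b • φ'.symm m := map_smul φ.symm _ _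
    rw [h]
    congr 1
    induction u using TensorProduct.induction_on with
    | zero => simp
    | add u v hu hv => simp only [map_add, LinearMap.add_apply, hu, hv]
    | tmul p r => rfl

end HomTensor

/-! ### Algebra maps out of a path algebra -/

section PathAlgebraHom

variable {k : Type w} [Field k] {V : Type u} [Quiver.{v} V]

/-- A subspace of the path algebra that contains all paths is everything. -/
theorem PathAlgebra.eq_top_of_forall_of_mem {N : Submodule k (PathAlgebra k V)}
    (h : ∀ p, PathAlgebra.of p ∈ N) : N = ⊤ := by
  have h0 : N.mkQ = 0 := PathAlgebra.hom_ext fun p => by simpa using h p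
  rw [← N.ker_mkQ, h0, LinearMap.ker_zero]

variable {A : Type*} [Ring A] [Algebra k A] {e : V → A}

/-- The product of the values of the arrows along a path, times the value of its source. -/
def pathVal (e : V → A) (val : ∀ {x y : V}, (x ⟶ y) → A) {x : V} :
    ∀ {y : V}, Quiver.Path x y → A
  | _, .nil => e x
  | _, .cons p a => val a * pathVal e val p

section

variable [Fintype V] {val : ∀ {x y : V}, (x ⟶ y) → A} (he : CompleteOrthogonalIdempotents e)
  (hl : ∀ {x y : V} (a : x ⟶ y), e y * val a = val a)
include he

include hl in
theorem mul_pathVal {x y : V} (p : Quiver.Path x y) :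
    e y * pathVal e val p = pathVal e val p := by
  cases p with
  | nil => exact he.idem x
  | cons p a => rw [pathVal, ← mul_assoc, hl]

theorem pathVal_mul {x y : V} (p : Quiver.Path x y) :
    pathVal e val p * e x = pathVal e val p := by
  induction p with
  | nil => exact he.idem x
  | cons p a ih => rw [pathVal, mul_assoc, ih]

include hl in
theorem pathVal_comp {x y z : V} (p : Quiver.Path x y) (q : Quiver.Path y z) :
    pathVal e val (p.comp q) = pathVal e val q * pathVal e val p := by
  induction q with
  | nil => rw [Quiver.Path.comp_nil, pathVal, mul_pathVal he hl]
  | cons q a ih => rw [Quiver.Path.comp_cons, pathVal, ih, pathVal, mul_assoc]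

/-- The universal property of the path algebra: an algebra map is given by a complete family of
orthogonal idempotents for the vertices and values of the arrows that are fixed by the idempotent
at the target. Compatibility with the sources is not needed, because `pathVal` multiplies by the
idempotent at the source of the path: an arrow `a : x ⟶ y` is sent to `val a * e x`. -/
noncomputable def PathAlgebra.liftAlgHom : PathAlgebra k V →ₐ[k] A :=
  AlgHom.ofLinearMap (PathAlgebra.lift fun p => pathVal e val p.path)
    (by
      rw [PathAlgebra.one_def, map_sum, ← he.complete]
      exact Finset.sum_congr rfl fun x _ => PathAlgebra.lift_of _ _)
    (fun a b => by
      have key : ∀ p q : QPath V, PathAlgebra.lift (k := k) (fun p => pathVal e val p.path)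
          (.of p * .of q) = pathVal e val p.path * pathVal e val q.path := by
        rintro ⟨x, y, p⟩ ⟨x', y', q⟩
        by_cases h : y' = x
        · subst h
          rw [PathAlgebra.of_mul_of_comp, PathAlgebra.lift_of, pathVal_comp he hl]
        · rw [PathAlgebra.of_mul_of_ne h, map_zero, ← pathVal_mul he p,
            ← mul_pathVal he hl q, mul_assoc, ← mul_assoc (e x),
            he.ortho (Ne.symm h), zero_mul, mul_zero]
      have h : (LinearMap.mul k (PathAlgebra k V)).compr₂
          (PathAlgebra.lift fun p => pathVal e val p.path) =
          (LinearMap.mul k A).compl₁₂ (PathAlgebra.lift fun p => pathVal e val p.path)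
            (PathAlgebra.lift fun p => pathVal e val p.path) :=
        PathAlgebra.hom_ext fun p => PathAlgebra.hom_ext fun q => by
          simpa using key p q
      exact LinearMap.congr_fun (LinearMap.congr_fun h a) b)

theorem PathAlgebra.liftAlgHom_of (p : QPath V) :
    PathAlgebra.liftAlgHom (k := k) he hl (.of p) = pathVal e val p.path :=
  PathAlgebra.lift_of _ _

end

end PathAlgebraHom

/-! ### The paths in a bound quiver algebra -/

section BoundQuiverAlgebraStructure

variable {k : Type w} {V : Type u} [Quiver.{v} V] [Field k] [Fintype V]

/-- The class of a path in `kQ/I`. -/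
noncomputable def pathClass (I : TwoSidedIdeal (PathAlgebra k V)) (p : QPath V) :
    BoundQuiverAlgebra I := Ideal.Quotient.mkₐ k I.asIdeal (.of p)

variable {I : TwoSidedIdeal (PathAlgebra k V)}

theorem pathClass_mul {x y z : V} (p : Quiver.Path x y) (q : Quiver.Path y z) :
    pathClass I ⟨y, z, q⟩ * pathClass I ⟨x, y, p⟩ = pathClass I ⟨x, z, p.comp q⟩ := by
  rw [pathClass, pathClass, ← map_mul, PathAlgebra.of_mul_of_comp, pathClass]

theorem pathClass_mul_of_ne {p q : QPath V} (h : q.tgt ≠ p.src) :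
    pathClass I p * pathClass I q = 0 := by
  rw [pathClass, pathClass, ← map_mul, PathAlgebra.of_mul_of_ne h, map_zero]

theorem pathClass_cons {x y z : V} (p : Quiver.Path x y) (a : y ⟶ z) :
    pathClass I ⟨x, z, p.cons a⟩ = pathClass I ⟨y, z, a.toPath⟩ * pathClass I ⟨x, y, p⟩ :=
  (pathClass_mul p a.toPath).symm

/-- A subspace of `kQ/I` that contains all paths is everything. -/
theorem eq_top_of_forall_pathClass_mem {N : Submodule k (BoundQuiverAlgebra I)}
    (h : ∀ p, pathClass I p ∈ N) : N = ⊤ := by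
  rw [eq_top_iff]
  intro b _
  obtain ⟨b, rfl⟩ := Ideal.Quotient.mkₐ_surjective k I.asIdeal b
  have := PathAlgebra.eq_top_of_forall_of_mem
    (N := N.comap (Ideal.Quotient.mkₐ k I.asIdeal).toLinearMap) h
  exact (this ▸ Submodule.mem_top :
    b ∈ N.comap (Ideal.Quotient.mkₐ k I.asIdeal).toLinearMap)

theorem completeOrthogonalIdempotents_vertex :
    CompleteOrthogonalIdempotents (BoundQuiverAlgebra.vertex I) where
  idem x := pathClass_mul (I := I) (.nil : Quiver.Path x x) .nil
  ortho x y h := pathClass_mul_of_ne (I := I) (p := ⟨x, x, .nil⟩) (q := ⟨y, y, .nil⟩) (Ne.symm h)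
  complete := by
    rw [← map_one (Ideal.Quotient.mkₐ k I.asIdeal), PathAlgebra.one_def, map_sum]
    rfl

variable (I) in
/-- The subspace of `kQ/I` spanned by the paths of length at least `l`. -/
noncomputable def pathFiltration (l : ℕ) : Submodule k (BoundQuiverAlgebra I) :=
  Submodule.span k {b | ∃ p : QPath V, l ≤ p.path.length ∧ pathClass I p = b}

theorem pathClass_eq_zero {n : ℕ} (hn : PathAlgebra.lengthIdeal k V n ≤ I) (p : QPath V)
    (hp : n ≤ p.path.length) : pathClass I p = 0 := by
  obtain ⟨x, y, p⟩ := p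
  induction p with
  | nil =>
    obtain rfl : n = 0 := by simpa using hp
    exact Ideal.Quotient.eq_zero_iff_mem.2
      (TwoSidedIdeal.mem_asIdeal.2 (hn (TwoSidedIdeal.subset_span ⟨_, rfl, rfl⟩)))
  | cons p a ih =>
    rcases Nat.lt_or_ge p.length n with h | h
    · have h' : (p.cons a).length = n := le_antisymm h hp
      exact Ideal.Quotient.eq_zero_iff_mem.2
        (TwoSidedIdeal.mem_asIdeal.2 (hn (TwoSidedIdeal.subset_span ⟨_, h', rfl⟩)))
    · rw [pathClass_cons, ih h, mul_zero]

theorem isBasicFiltration (hI : PathAlgebra.IsAdmissible I) :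
    IsBasicFiltration (BoundQuiverAlgebra.vertex I) (pathFiltration I) where
  orthogonal := completeOrthogonalIdempotents_vertex.toOrthogonalIdempotents
  zero := eq_top_of_forall_pathClass_mem fun p => Submodule.subset_span ⟨p, Nat.zero_le _, rfl⟩
  mul {l m a b} ha hb := by
    have h := Submodule.mul_mem_mul ha hb
    rw [pathFiltration, pathFiltration, Submodule.span_mul_span] at h
    refine Submodule.span_le.2 ?_ h
    rintro _ ⟨_, ⟨⟨x, y, p⟩, hp, rfl⟩, _, ⟨⟨x', y', q⟩, hq, rfl⟩, rfl⟩
    by_cases hyx : y' = x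
    · subst hyx
      refine Submodule.subset_span ⟨⟨x', y, q.comp p⟩, ?_, (pathClass_mul q p).symm⟩
      rw [Quiver.Path.length_comp, add_comm]
      exact add_le_add hq hp
    · simp only [SetLike.mem_coe]
      rw [pathClass_mul_of_ne hyx]
      exact Submodule.zero_mem _
  nilpotent := by
    obtain ⟨n, -, hn, -⟩ := hI
    refine ⟨n, Submodule.span_eq_bot.2 ?_⟩
    rintro _ ⟨p, hp, rfl⟩
    exact pathClass_eq_zero hn p hp
  exists_sub_mem b := by
    have h : Submodule.span k (Set.range (BoundQuiverAlgebra.vertex I)) ⊔ pathFiltration I 1 =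
        ⊤ := by
      refine eq_top_of_forall_pathClass_mem fun p => ?_
      obtain ⟨x, y, p⟩ := p
      cases p with
      | nil => exact Submodule.mem_sup_left (Submodule.subset_span ⟨x, rfl⟩)
      | cons p a =>
        exact Submodule.mem_sup_right (Submodule.subset_span ⟨_, Nat.le_add_left 1 _, rfl⟩)
    obtain ⟨y, hy, z, hz, hyz⟩ := Submodule.mem_sup.1 (h ▸ Submodule.mem_top : b ∈ _)
    obtain ⟨c, rfl⟩ := (Submodule.mem_span_range_iff_exists_fun k).1 hy
    exact ⟨c, by rwa [← hyz, add_sub_cancel_left]⟩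

theorem finite_paths_of_length [∀ x y : V, Finite (x ⟶ y)] (n : ℕ) :
    Finite {p : QPath V // p.path.length = n} := by
  induction n with
  | zero =>
    refine Finite.of_surjective (fun x : V => (⟨⟨x, x, .nil⟩, rfl⟩ :
      {p : QPath V // p.path.length = 0})) ?_
    rintro ⟨⟨x, y, p⟩, h⟩
    cases p with
    | nil => exact ⟨x, rfl⟩
    | cons p a => simp at h
  | succ n ih =>
    refine Finite.of_surjective
      (fun q : (Σ p : {p : QPath V // p.path.length = n}, Σ y : V, (p.1.tgt ⟶ y)) =>
        (⟨⟨q.1.1.src, q.2.1, q.1.1.path.cons q.2.2⟩, congrArg (· + 1) q.1.2⟩ :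
        {p : QPath V // p.path.length = n + 1})) ?_
    rintro ⟨⟨x, y, p⟩, h⟩
    cases p with
    | nil => simp at h
    | cons p a => exact ⟨⟨⟨⟨_, _, p⟩, Nat.succ_injective h⟩, _, a⟩, rfl⟩

theorem finiteDimensional_boundQuiverAlgebra [∀ x y : V, Finite (x ⟶ y)]
    (hI : PathAlgebra.IsAdmissible I) : FiniteDimensional k (BoundQuiverAlgebra I) := by
  obtain ⟨n, -, hn, -⟩ := hI
  have hfin : (⋃ m ∈ Finset.range n, {p : QPath V | p.path.length = m}).Finite :=
    Set.Finite.biUnion (Finset.finite_toSet _) fun m _ => finite_paths_of_length m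
  have h : Submodule.span k (pathClass I ''
      ⋃ m ∈ Finset.range n, {p : QPath V | p.path.length = m}) = ⊤ := by
    refine eq_top_of_forall_pathClass_mem fun p => ?_
    rcases Nat.lt_or_ge p.path.length n with h | h
    · exact Submodule.subset_span ⟨p, by simpa using h, rfl⟩
    · rw [pathClass_eq_zero hn p h]
      exact Submodule.zero_mem _
  exact ⟨h ▸ Submodule.fg_span (hfin.image _)⟩

end BoundQuiverAlgebraStructure

/-! ### The algebra with new arrows -/

section NewArrows

variable {k : Type w} {V : Type u} [Quiver.{v} V] [Field k] [Fintype V] {F : Type v} (s t : F → V)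
  (I : TwoSidedIdeal (PathAlgebra k V))

/-- The class in `B_F` of a new arrow. -/
noncomputable def newArrow (a : F) : BF s t I :=
  pathClass (addArrowsIdeal s t I) ⟨s a, t a, Quiver.Hom.toPath
    (show @Quiver.Hom (AddArrows s t) _ (s a) (t a) from Sum.inr ⟨a, rfl, rfl⟩)⟩

/-- The class in `B_F` of a path of `Q`. -/
noncomputable def oldPathClass (p : QPath V) : BF s t I :=
  pathClass (addArrowsIdeal s t I) ⟨(AddArrows.incl s t).obj p.src, (AddArrows.incl s t).obj p.tgt,
      (AddArrows.incl s t).mapPath p.path⟩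

theorem oldPathClass_mul {x y z : V} (p : Quiver.Path x y) (q : Quiver.Path y z) :
    oldPathClass s t I ⟨y, z, q⟩ * oldPathClass s t I ⟨x, y, p⟩ =
      oldPathClass s t I ⟨x, z, p.comp q⟩ := by
  simp only [oldPathClass, pathClass_mul, Prefunctor.mapPath_comp]

theorem completeOrthogonalIdempotents_oldVertex :
    CompleteOrthogonalIdempotents fun x : V =>
      BoundQuiverAlgebra.vertex (addArrowsIdeal s t I) ((AddArrows.incl s t).obj x) :=
  completeOrthogonalIdempotents_vertex (I := addArrowsIdeal s t I)

/-- The algebra map `kQ → B_F`. -/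
noncomputable def oldHom : PathAlgebra k V →ₐ[k] BF s t I :=
  PathAlgebra.liftAlgHom (e := fun x : V =>
      BoundQuiverAlgebra.vertex (addArrowsIdeal s t I) ((AddArrows.incl s t).obj x))
    (val := fun {x y} a => oldPathClass s t I ⟨x, y, a.toPath⟩)
    (completeOrthogonalIdempotents_oldVertex s t I)
    (fun {_ y} a => oldPathClass_mul s t I a.toPath (.nil : Quiver.Path y y))

theorem oldHom_of (p : QPath V) : oldHom s t I (.of p) = oldPathClass s t I p := by
  obtain ⟨x, y, p⟩ := p
  refine (PathAlgebra.lift_of _ _).trans ?_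
  dsimp only
  induction p with
  | nil => rfl
  | cons p a ih =>
    rw [pathVal, ih, oldPathClass_mul]
    rfl

theorem oldHom_apply (z : PathAlgebra k V) : oldHom s t I z =
    Ideal.Quotient.mkₐ k (addArrowsIdeal s t I).asIdeal (PathAlgebra.incl s t z) := by
  have h : (oldHom s t I).toLinearMap =
      (Ideal.Quotient.mkₐ k (addArrowsIdeal s t I).asIdeal).toLinearMap ∘ₗ
        PathAlgebra.incl s t := PathAlgebra.hom_ext fun p => by
    refine (oldHom_of s t I p).trans ?_
    rw [LinearMap.comp_apply, PathAlgebra.incl, PathAlgebra.lift_of]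
    rfl
  exact LinearMap.congr_fun h z

/-- The algebra map `B → B_F`. -/
noncomputable def baseHom : BoundQuiverAlgebra I →ₐ[k] BF s t I :=
  Ideal.Quotient.liftₐ I.asIdeal (oldHom s t I) fun z hz => by
    rw [oldHom_apply]
    exact Ideal.Quotient.eq_zero_iff_mem.2 (TwoSidedIdeal.mem_asIdeal.2
      (TwoSidedIdeal.subset_span ⟨z, TwoSidedIdeal.mem_asIdeal.1 hz, rfl⟩))

theorem baseHom_mk (z : PathAlgebra k V) :
    baseHom s t I (Ideal.Quotient.mkₐ k I.asIdeal z) = oldHom s t I z := rfl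

theorem baseHom_pathClass (p : QPath V) :
    baseHom s t I (pathClass I p) = oldPathClass s t I p := oldHom_of s t I p

theorem baseHom_vertex (x : V) : baseHom s t I (BoundQuiverAlgebra.vertex I x) =
    BoundQuiverAlgebra.vertex (addArrowsIdeal s t I) ((AddArrows.incl s t).obj x) :=
  baseHom_pathClass s t I ⟨x, x, .nil⟩

theorem baseHom_tgt_mul_newArrow (a : F) :
    baseHom s t I (BoundQuiverAlgebra.vertex I (t a)) * newArrow s t I a = newArrow s t I a := by
  rw [baseHom_vertex]
  exact pathClass_mul (V := AddArrows s t) _ .nil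

theorem newArrow_mul_baseHom_src (a : F) :
    newArrow s t I a * baseHom s t I (BoundQuiverAlgebra.vertex I (s a)) = newArrow s t I a := by
  rw [baseHom_vertex]
  exact (pathClass_mul (V := AddArrows s t) .nil _).trans
    (congrArg (fun q => pathClass (addArrowsIdeal s t I) ⟨s a, t a, q⟩)
      (Quiver.Path.nil_comp (V := AddArrows s t) _))

/-- The algebra `B_F` is generated by `B` and the new arrows. -/
theorem adjoin_baseHom_newArrow :
    Algebra.adjoin k (Set.range (baseHom s t I) ∪ Set.range (newArrow s t I)) = ⊤ := by
  refine Subalgebra.toSubmodule_injective ?_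
  rw [Algebra.top_toSubmodule]
  refine eq_top_of_forall_pathClass_mem fun p => ?_
  rw [Subalgebra.mem_toSubmodule]
  obtain ⟨x, y, p⟩ := p
  induction p with
  | nil =>
    exact Algebra.subset_adjoin (Or.inl ⟨_, baseHom_vertex s t I x⟩)
  | @cons y z p a ih =>
    rw [pathClass_cons]
    refine Subalgebra.mul_mem _ (Algebra.subset_adjoin ?_) ih
    rcases a with a | ⟨a, rfl, rfl⟩
    · exact Or.inl ⟨_, baseHom_pathClass s t I ⟨y, z, Quiver.Hom.toPath (V := V) a⟩⟩
    · exact Or.inr ⟨a, rfl⟩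

variable {I}

/-- The universal property of `B_F` over `B`. -/
theorem exists_lift {A : Type*} [Ring A] [Algebra k A] (f : BoundQuiverAlgebra I →ₐ[k] A)
    (n : F → A) (hl : ∀ a, f (BoundQuiverAlgebra.vertex I (t a)) * n a = n a)
    (hr : ∀ a, n a * f (BoundQuiverAlgebra.vertex I (s a)) = n a) :
    ∃ g : BF s t I →ₐ[k] A, (∀ b, g (baseHom s t I b) = f b) ∧
      ∀ a, g (newArrow s t I a) = n a := by
  let e : AddArrows s t → A := fun x => f (BoundQuiverAlgebra.vertex I (show V from x))
  let val : ∀ {x y : AddArrows s t}, (x ⟶ y) → A := fun {x y} a =>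
    Sum.elim (fun a : @Quiver.Hom V _ x y => f (pathClass I ⟨x, y, a.toPath⟩))
      (fun a : {a : F // s a = x ∧ t a = y} => n a.1) a
  have he : CompleteOrthogonalIdempotents e :=
    (completeOrthogonalIdempotents_vertex (I := I)).map f.toRingHom
  have hl' : ∀ {x y : AddArrows s t} (a : x ⟶ y), e y * val a = val a := by
    intro x y a
    rcases a with a | ⟨a, rfl, rfl⟩
    · change f _ * f _ = f _
      rw [← map_mul]
      exact congrArg f (pathClass_mul (V := V) (Quiver.Hom.toPath (V := V) a) .nil)
    · exact hl a
  let g₀ : PathAlgebra k (AddArrows s t) →ₐ[k] A := PathAlgebra.liftAlgHom he hl'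
  have hg₀ : ∀ z : PathAlgebra k V,
      g₀ (PathAlgebra.incl s t z) = f (Ideal.Quotient.mkₐ k I.asIdeal z) := by
    have h : g₀.toLinearMap ∘ₗ PathAlgebra.incl s t =
        f.toLinearMap ∘ₗ (Ideal.Quotient.mkₐ k I.asIdeal).toLinearMap :=
      PathAlgebra.hom_ext fun p => by
        rw [LinearMap.comp_apply, PathAlgebra.incl, PathAlgebra.lift_of]
        refine (PathAlgebra.liftAlgHom_of he hl' _).trans ?_
        obtain ⟨x, y, p⟩ := p
        change pathVal _ _ _ = f (pathClass I ⟨x, y, p⟩)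
        induction p with
        | nil => rfl
        | cons p a ih =>
          rw [pathClass_cons, map_mul, ← ih]
          rfl
    exact LinearMap.congr_fun h
  have hker : addArrowsIdeal s t I ≤ TwoSidedIdeal.ker g₀.toRingHom := by
    refine TwoSidedIdeal.span_le.2 ?_
    rintro _ ⟨z, hz, rfl⟩
    refine TwoSidedIdeal.mem_ker _ |>.2 ((hg₀ z).trans ?_)
    rw [show Ideal.Quotient.mkₐ k I.asIdeal z = 0 from
      Ideal.Quotient.eq_zero_iff_mem.2 (TwoSidedIdeal.mem_asIdeal.2 hz), map_zero]
  refine ⟨Ideal.Quotient.liftₐ _ g₀ fun z hz =>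
    (TwoSidedIdeal.mem_ker _).1 (hker (TwoSidedIdeal.mem_asIdeal.1 hz)), fun b => ?_, fun a => ?_⟩
  · obtain ⟨z, rfl⟩ := Ideal.Quotient.mkₐ_surjective k I.asIdeal b
    rw [baseHom_mk, oldHom_apply]
    exact hg₀ z
  · refine (PathAlgebra.liftAlgHom_of he hl' _).trans ?_
    exact hr a

end NewArrows

/-! ### The pairs of a new arrow and a parallel extended relative path -/

section ParallelPairs

variable {k : Type w} {V : Type u} [Quiver.{v} V] [Field k] [Fintype V]
  {F : Type v} {s t : F → V} {I : TwoSidedIdeal (PathAlgebra k V)}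

/-- The elements of `F // W_*`, sorted into those with an extended relative path of length zero and
those with one of positive length. -/
def ParallelPairs.sumEquiv :
    {a : F // corner I (t a) (s a) ≠ ⊥} ⊕ {q : F × RelPath s t I //
      corner I (t q.1) q.2.tgt ≠ ⊥ ∧ corner I q.2.src (s q.1) ≠ ⊥} ≃ ParallelPairs s t I where
  toFun
    | .inl a => ⟨⟨a.1, .zero _ _ a.2⟩, rfl, rfl⟩
    | .inr q => ⟨⟨q.1.1, .pos _ q.1.2 _ q.2.1 q.2.2⟩, rfl, rfl⟩
  invFun
    | ⟨⟨a, .zero _ _ h⟩, hs, ht⟩ => .inl ⟨a, by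
        obtain rfl : s a = _ := hs
        obtain rfl : t a = _ := ht
        exact h⟩
    | ⟨⟨a, .pos _ γ _ h h'⟩, hs, ht⟩ => .inr ⟨⟨a, γ⟩, by
        obtain rfl : s a = _ := hs
        obtain rfl : t a = _ := ht
        exact ⟨h, h'⟩⟩
  left_inv q := by rcases q with q | q <;> rfl
  right_inv := by
    rintro ⟨⟨a, ⟨_, _, h⟩ | ⟨_, γ, _, h, h'⟩⟩, hs, ht⟩
    · refine Subtype.ext (Prod.ext rfl ?_)
      change ExtRelPath.zero (t a) (s a) _ = _
      congr 1
    · refine Subtype.ext (Prod.ext rfl ?_)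
      change ExtRelPath.pos (t a) γ (s a) _ _ = _
      congr 1

theorem ParallelPairs.finite [Finite F] [Finite (RelPath s t I)] :
    Finite (ParallelPairs s t I) :=
  Finite.of_equiv _ ParallelPairs.sumEquiv

theorem sum_subtype_of_forall_eq_zero {X : Type*} [Fintype X] {p : X → Prop}
    [Fintype {x // p x}] (f : X → ℤ) (h : ∀ x, ¬ p x → f x = 0) :
    ∑ x : {x // p x}, f x = ∑ x, f x := by
  classical
  refine (Finset.sum_subtype (Finset.univ.filter p) (fun x => by simp) f).symm.trans ?_
  exact Finset.sum_subset (Finset.subset_univ _) fun x _ hx => h x <| by simpa using hx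

theorem sum_parallelPairs [Fintype F] [Fintype (RelPath s t I)] [Fintype (ParallelPairs s t I)] :
    ∑ q : ParallelPairs s t I, (q.1.2.dim : ℤ) =
      ∑ a : F, ((Module.finrank k (corner I (t a) (s a)) : ℤ) + ∑ γ : RelPath s t I, (γ.dim : ℤ) *
        (Module.finrank k (corner I (t a) γ.tgt) * Module.finrank k (corner I γ.src (s a)))) := by
  classical
  rw [← ParallelPairs.sumEquiv.sum_comp, Fintype.sum_sum_type, Finset.sum_add_distrib,
    ← Fintype.sum_prod_type' (f := fun (a : F) (γ : RelPath s t I) => (γ.dim : ℤ) *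
        (Module.finrank k (corner I (t a) γ.tgt) * Module.finrank k (corner I γ.src (s a)))),
    ← sum_subtype_of_forall_eq_zero (p := fun a : F => corner I (t a) (s a) ≠ ⊥),
    ← sum_subtype_of_forall_eq_zero (X := F × RelPath s t I)
      (p := fun q => corner I (t q.1) q.2.tgt ≠ ⊥ ∧ corner I q.2.src (s q.1) ≠ ⊥)]
  · congr 1
    refine Finset.sum_congr rfl fun q _ => ?_
    change (((Module.finrank k (corner I (t q.1.1) q.1.2.tgt) * q.1.2.dim *
      Module.finrank k (corner I q.1.2.src (s q.1.1)) : ℕ)) : ℤ) = _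
    push_cast
    ring
  · rintro ⟨a, γ⟩ h
    rw [not_and_or, not_not, not_not] at h
    rcases h with h | h
    · simp only at h
      rw [h, finrank_bot, Nat.cast_zero, zero_mul, mul_zero]
    · simp only at h
      rw [h, finrank_bot, Nat.cast_zero, mul_zero, mul_zero]
  · intro a h
    rw [not_not.1 h, finrank_bot, Nat.cast_zero]

end ParallelPairs

/-! ### The comparison of the Hochschild cohomologies -/

section Comparison

variable {k : Type w} [Field k] {B T : Type*} [Ring B] [Algebra k B] [Ring T] [Algebra k T]
  [FiniteDimensional k B] {F : Type*} [Fintype F] {σ τ : F → B} {ι : B →ₐ[k] T} {arr : F → T}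
  [Fintype (Word k σ τ)]

/-- The comparison of `T` with `B`, for an algebra `T` with the universal property of `B` with the
arrows `arr a : σ a → τ a` adjoined. The universal property is used for the endomorphisms of the
model, which shows that `T` is isomorphic to it, and for the square zero extension of `T`, which
extends derivations of `B` in `T`. -/
theorem finrank_HH1_sub_finrank_HH1 (hσ : ∀ a, IsIdempotentElem (σ a))
    (hτ : ∀ a, IsIdempotentElem (τ a)) (hl : ∀ a, ι (τ a) * arr a = arr a)
    (hr : ∀ a, arr a * ι (σ a) = arr a)
    (hadj : Algebra.adjoin k (Set.range ι ∪ Set.range arr) = ⊤)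
    (hend : ∀ (f : B →ₐ[k] Module.End k (TensorModel k σ τ))
      (n : F → Module.End k (TensorModel k σ τ)),
      (∀ a, f (τ a) * n a = n a) → (∀ a, n a * f (σ a) = n a) →
      ∃ g : T →ₐ[k] Module.End k (TensorModel k σ τ),
        (∀ b, g (ι b) = f b) ∧ ∀ a, g (arr a) = n a)
    (hlift : ∀ (f : B →ₐ[k] TrivSqZeroExt T T) (n : F → TrivSqZeroExt T T),
      (∀ a, f (τ a) * n a = n a) → (∀ a, n a * f (σ a) = n a) →
      ∃ g : T →ₐ[k] TrivSqZeroExt T T, (∀ b, g (ι b) = f b) ∧ ∀ a, g (arr a) = n a) :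
    FiniteDimensional k T ∧
      (Module.finrank k (HH1 k T) : ℤ) - Module.finrank k (HH1 k B) =
        (Module.finrank k (Subalgebra.center k T) : ℤ) - Module.finrank k (Subalgebra.center k B) +
        ∑ a, ((Module.finrank k (cornerSpace k (τ a) (σ a)) : ℤ) +
          ∑ w : Word k σ τ, (Module.finrank k (cornerSpace k (τ a) (τ w.tgt)) : ℤ) *
            Module.finrank k (cornerSpace k (σ w.src) (σ a))) +
        ∑ w : Word k σ τ, ((Module.finrank k (derivations
          (tensorLeft k (τ w.tgt) (σ w.src)) (tensorRight k (τ w.tgt) (σ w.src))) : ℤ) -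
          Module.finrank k (leftIdeal (τ w.tgt)) * Module.finrank k (rightIdeal (σ w.src))) := by
  obtain ⟨ρ, hρ, hρ'⟩ := hend (Algebra.lsmul k k (TensorModel k σ τ)) (arrowOp hσ hτ)
    (fun a => LinearMap.ext fun m => smul_arrowOp hσ hτ a m)
    (fun a => LinearMap.ext fun m => arrowOp_smul hσ hτ a m)
  have hψ := modelMap_bijective hσ hτ hl hr hadj ρ (fun b m => LinearMap.congr_fun (hρ b) m) hρ'
  have hT : FiniteDimensional k T := finiteDimensional_of_modelMap_bijective hψ
  refine ⟨hT, ?_⟩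
  have hdT := finrank_derivations_restrict hσ hτ hl hr hadj hlift
  have hd := finrank_derivations_of_modelMap_bijective hψ
  have hdim := finrank_of_modelMap_bijective hψ
  have hcorner := fun a => finrank_cornerSpace_of_modelMap_bijective hψ hσ hτ (τ a) (σ a)
  have hHT := finrank_HH1 k T
  have hHB := finrank_HH1 k B
  simp only [hcorner] at hdT
  zify at hdT hd hdim
  rw [Finset.sum_sub_distrib]
  linarith

end Comparison

/-! ### The modules of a bound quiver algebra -/

section IndecomposableModules

variable {k : Type w} {V : Type u} [Quiver.{v} V] [Field k] [Fintype V]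
  [∀ x y : V, Finite (x ⟶ y)] {I : TwoSidedIdeal (PathAlgebra k V)}

/-- The difference of the dimensions of `Ext¹_B(I_x, P_y)` and `Hom_B(I_x, P_y)` in terms of the
bimodule `By ⊗ xB`, which is a contribution of the words from `x` to `y` to `B_F`. -/
theorem finrank_ext_of_isSimpleAt (hI : PathAlgebra.IsAdmissible I)
    {x y : V} {S S' E P : ModuleCat.{max u v w} (BoundQuiverAlgebra I)}
    (hS : IsSimpleAt I x S) (hS' : IsSimpleAt I y S')
    (hE : IsInjectiveEnvelope (BoundQuiverAlgebra I) E S)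
    (hP : IsProjectiveCover (BoundQuiverAlgebra I) P S') :
    Module.Finite k (E ⟶ P) ∧ Module.Finite k (Abelian.Ext E P 1) ∧
      (Module.finrank k (Abelian.Ext E P 1) : ℤ) - Module.finrank k (E ⟶ P) =
        Module.finrank k (derivations
          (tensorLeft k (BoundQuiverAlgebra.vertex I y) (BoundQuiverAlgebra.vertex I x))
          (tensorRight k (BoundQuiverAlgebra.vertex I y) (BoundQuiverAlgebra.vertex I x))) -
        Module.finrank k (leftIdeal (BoundQuiverAlgebra.vertex I y)) *
          Module.finrank k (rightIdeal (BoundQuiverAlgebra.vertex I x)) := by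
  have := finiteDimensional_boundQuiverAlgebra hI
  have hJ := isBasicFiltration hI
  obtain ⟨hS, hm⟩ := hS
  obtain ⟨hS', hm'⟩ := hS'
  obtain ⟨hE, ι, hι, hess⟩ := hE
  obtain ⟨hP, π, hπ, hsup⟩ := hP
  obtain ⟨φ⟩ := hJ.nonempty_equiv_of_isInjectiveEnvelope (B := BoundQuiverAlgebra I)
    (E := E) (S := S) hE ι hι hess hm
  obtain ⟨ψ⟩ := hJ.nonempty_equiv_of_isProjectiveCover π hπ hsup hm'
  exact finrank_ext_of_equiv E P φ.symm ψ.symm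

end IndecomposableModules

theorem theorem4p2 {k : Type w} [Field k] {V : Type u} [Quiver.{v} V] [Fintype V]
    [∀ x y : V, Finite (x ⟶ y)]
    (I : TwoSidedIdeal (PathAlgebra k V)) (hI : PathAlgebra.IsAdmissible I)
    {F : Type v} [Finite F] (s t : F → V)
    (hF : ∀ γ : RelPath s t I, ¬ γ.IsCycle)
    (S P J : V → ModuleCat.{max u v w} (BoundQuiverAlgebra I))
    (hS : ∀ x, IsSimpleAt I x (S x))
    (hP : ∀ x, IsProjectiveCover (BoundQuiverAlgebra I) (P x) (S x))
    (hJ : ∀ x, IsInjectiveEnvelope (BoundQuiverAlgebra I) (J x) (S x)) :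
    Module.Finite k (BoundQuiverAlgebra I) ∧ Module.Finite k (BF s t I) ∧
    Finite (RelPath s t I) ∧ Finite (ParallelPairs s t I) ∧
    (∀ x y : V, Module.Finite k (J x ⟶ P y) ∧
      Module.Finite k (Abelian.Ext (J x) (P y) 1)) ∧
    (Module.finrank k (HH1 k (BF s t I)) : ℤ) - Module.finrank k (HH1 k (BoundQuiverAlgebra I)) =
      (Module.finrank k (Subalgebra.center k (BF s t I)) : ℤ) -
        Module.finrank k (Subalgebra.center k (BoundQuiverAlgebra I)) +
      ∑ᶠ q : ParallelPairs s t I, (q.1.2.dim : ℤ) +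
      ∑ᶠ γ : RelPath s t I, (γ.dim : ℤ) *
        ((Module.finrank k (Abelian.Ext (J γ.src) (P γ.tgt) 1) : ℤ) -
          Module.finrank k (J γ.src ⟶ P γ.tgt)) := by
  have hB : FiniteDimensional k (BoundQuiverAlgebra I) := finiteDimensional_boundQuiverAlgebra hI
  let _ : Fintype F := Fintype.ofFinite F
  have hR : Finite (RelPath s t I) := RelPath.finite hF
  let _ : Fintype (RelPath s t I) := Fintype.ofFinite _
  have hPP : Finite (ParallelPairs s t I) := ParallelPairs.finite
  let _ : Fintype (ParallelPairs s t I) := Fintype.ofFinite _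
  have hW : Finite (WordOf fun a b => Module.finrank k (corner I (s a) (t b))) :=
    finite_wordOf (RelPath.chain_imp_eq_zero hF)
  let _ : Fintype (WordOf fun a b => Module.finrank k (corner I (s a) (t b))) :=
    Fintype.ofFinite _
  let _ : Fintype (Word k (fun a => BoundQuiverAlgebra.vertex I (s a))
    fun a => BoundQuiverAlgebra.vertex I (t a)) :=
    inferInstanceAs (Fintype (WordOf fun a b => Module.finrank k (corner I (s a) (t b))))
  have hidem := (completeOrthogonalIdempotents_vertex (I := I)).idem
  have hExt := fun x y => finrank_ext_of_isSimpleAt hI (hS x) (hS y) (hJ x) (hP y)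
  obtain ⟨hT, h⟩ := finrank_HH1_sub_finrank_HH1 (fun a => hidem (s a)) (fun a => hidem (t a))
    (baseHom_tgt_mul_newArrow s t I) (newArrow_mul_baseHom_src s t I)
    (adjoin_baseHom_newArrow s t I)
    (fun f n hl hr => @exists_lift k V _ _ _ F s t I _ _ _ f n hl hr)
    (fun f n hl hr => exists_lift s t f n hl hr)
  refine ⟨hB, hT, hR, hPP, fun x y => ⟨(hExt x y).1, (hExt x y).2.1⟩, h.trans ?_⟩
  -- it remains to sort the words by the underlying relative paths
  rw [finsum_eq_sum_of_fintype, finsum_eq_sum_of_fintype, sum_parallelPairs]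
  refine congrArg₂ (· + ·) (congrArg₂ (· + ·) rfl (Finset.sum_congr rfl fun a _ =>
    congrArg₂ (· + ·) rfl ?_)) ?_
  · exact sum_word_eq_sum_relPath hF fun x y =>
      (Module.finrank k (corner I (t a) y) : ℤ) * Module.finrank k (corner I x (s a))
  · refine (Finset.sum_congr rfl fun w _ => (hExt (s w.src) (t w.tgt)).2.2.symm).trans ?_
    exact sum_word_eq_sum_relPath hF fun x y =>
      (Module.finrank k (Abelian.Ext (J x) (P y) 1) : ℤ) - Module.finrank k (J x ⟶ P y)
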